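/- For $n\ge 0$ let $\Pi(n)$ be the set of set partitions of $[n]=\{1,\dots,n\}$. For $\lambda\in\Pi(n)$ write $i\sim_\lambda j$ if $i,j$ lie in the same block of $\lambda$; let $\mathbf{First}(\lambda)$ (resp. $\mathbf{Last}(\lambda)$) be the set of smallest (resp. largest) elements of blocks of $\lambda$, and let $\mathbf{Arc}(\lambda)$ be the set of pairs $(i,j)$ such that $j$ is the smallest element greater than $i$ in the block of $i$. A pattern $\underline P=(P,\mathbf F,\mathbf L,\mathbf A,\mathbf C)$ of length $k\ge 0$ consists of a set partition $P$ of $[k]$ and subsets $\mathbf F,\mathbf L\subseteq[k]$, $\mathbf A,\mathbf C\subseteq[k]\times[k]$. An occurrence of $\underline P$ in $\lambda\in\Pi(n)$, written $s\in_{\underline P}\lambda$, is a tuple $s=(x_1,\dots,x_k)\in[n]^k$ with $x_1<\dots<x_k$; $x_i\sim_\lambda x_j$ if and only if $i\sim_P j$; $x_i\in\mathbf{First}(\lambda)$ for $i\in\mathbf F$; $x_i\in\mathbf{Last}(\lambda)$ for $i\in\mathbf L$; $(x_i,x_j)\in\mathbf{Arc}(\lambda)$ for $(i,j)\in\mathbf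 A$; and $|x_i-x_j|=1$ for $(i,j)\in\mathbf C$. For $Q\in\mathbb Z[y_1,\dots,y_k,m]$ the simple statistic $f_{\underline P,Q}$ is $$f_{\underline P,Q}(\lambda)=\sum_{(x_1,\dots,x_k)\in_{\underline P}\lambda}Q(x_1,\dots,x_k,n)\qquad(\lambda\in\Pi(n)),$$ and its degree is $k+\deg Q$ (with $\deg 0=0$). A statistic is a function $f:\bigcup_{n\ge0}\Pi(n)\to\mathbb Q$ that is a finite $\mathbb Q$-linear combination of simple statistics; its degree is the minimum, over all such representations of $f$, of the maximal degree of a simple statistic that appears (the maximum over an empty combination being $0$). Let $B_m$ be the $m$-th Bell number for $m\ge 0$, and put $B_m=0$ for $m<0$. **Theorem 2.2.** Let $f$ be a statistic of degree $N$, and let $k$ be the maximal length of a pattern that appears in some given representation of $f$ as a finite $\mathbb Q$-linear combination of simple statistics ($k=0$ for the empty combination). Then there are polynomials $Q_j\in\mathbb Q[x]$, $-k\le j\le N$, such that $$M(f;n):=\sum_{\lambda\in\Pi(n)}f(\lambda)=\sum_{-k\le j\le N}Q_j(n)\,B_{n+j}\qquad\text{for all } n\ge\max(1,k-1),$$ and,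 for every integer $0\le j\le N+k$, the coefficient $Q_{N-j}$ of $B_{n+N-j}$ has degree at most $j$ if $j\le N$ and at most $j-1$ if $j>N$. (The number $B_{-1}$ can occur only for $n=k-1$.) -/

import Mathlib

open Finset

namespace SetPartitionStat

/-- Set partitions of `[n]`. The element `i : Fin n` stands for the integer `i + 1 ∈ [n]`. -/
abbrev SetPartition (n : ℕ) : Type := Finpartition (univ : Finset (Fin n))

/-- `i ∼ j`: the elements `i` and `j` lie in the same block. -/
def Rel {n : ℕ} (l : SetPartition n) (i j : Fin n) : Prop :=
  ∃ b ∈ l.parts, i ∈ b ∧ j ∈ b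

/-- `i` is the smallest element of its block. -/
def IsFirst {n : ℕ} (l : SetPartition n) (i : Fin n) : Prop :=
  ∀ j, Rel l i j → i ≤ j

/-- `i` is the largest element of its block. -/
def IsLast {n : ℕ} (l : SetPartition n) (i : Fin n) : Prop :=
  ∀ j, Rel l i j → j ≤ i

/-- `(i, j)` is an arc: `j` is the smallest element of the block of `i` that is greater
than `i`. -/
def IsArc {n : ℕ} (l : SetPartition n) (i j : Fin n) : Prop :=
  Rel l i j ∧ i < j ∧ ∀ h, Rel l i h → i < h → j ≤ h

/-- A pattern of length `k`: a set partition of `[k]`, together with subsets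
`F, L ⊆ [k]` and `A, C ⊆ [k] × [k]`. -/
structure Pattern (k : ℕ) where
  partition : SetPartition k
  firsts : Finset (Fin k)
  lasts : Finset (Fin k)
  arcs : Finset (Fin k × Fin k)
  consec : Finset (Fin k × Fin k)

/-- `s = (x_1, …, x_k)` is an occurrence of the pattern `P` in the set partition `l`. -/
structure IsOccurrence {k n : ℕ} (P : Pattern k) (l : SetPartition n) (s : Fin k → Fin n) :
    Prop where
  strictMono : StrictMono s
  rel_iff : ∀ i j, Rel l (s i) (s j) ↔ Rel P.partition i j
  isFirst : ∀ i ∈ P.firsts, IsFirst l (s i)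
  isLast : ∀ i ∈ P.lasts, IsLast l (s i)
  isArc : ∀ p ∈ P.arcs, IsArc l (s p.1) (s p.2)
  consec : ∀ p ∈ P.consec, |((s p.1 : ℕ) : ℤ) - ((s p.2 : ℕ) : ℤ)| = 1

/-- The data of a simple statistic: a pattern of length `k` and a polynomial
`Q ∈ ℤ[y_1, …, y_k, m]`. The variable `some i` is `y_i`, the variable `none` is `m`. -/
structure SimpleStatistic where
  length : ℕ
  pattern : Pattern length
  poly : MvPolynomial (Option (Fin length)) ℤ

open Classical in
/-- The value `f_{P,Q}(l) = ∑_{s ∈_P l} Q(s)`, where `Q(s)` is `Q` at `y_i = x_i`, `m = n`. -/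
noncomputable def SimpleStatistic.value (σ : SimpleStatistic) {n : ℕ} (l : SetPartition n) : ℤ :=
  ∑ s : Fin σ.length → Fin n with IsOccurrence σ.pattern l s,
    MvPolynomial.eval (fun v : Option (Fin σ.length) =>
      v.elim (n : ℤ) (fun i => ((s i : ℕ) : ℤ) + 1)) σ.poly

/-- The degree of a simple statistic: the length of its pattern plus the degree of `Q`. -/
noncomputable def SimpleStatistic.degree (σ : SimpleStatistic) : ℕ :=
  σ.length + σ.poly.totalDegree

/-- The finite `ℚ`-linear combination `c` of simple statistics represents the function `f` on
all set partitions. -/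
def Represents (c : SimpleStatistic →₀ ℚ) (f : (n : ℕ) → SetPartition n → ℚ) : Prop :=
  ∀ (n : ℕ) (l : SetPartition n), f n l = c.sum fun σ a => a * (σ.value l : ℚ)

/-- The largest degree of a simple statistic that appears in the linear combination `c`. -/
noncomputable def maxDegree (c : SimpleStatistic →₀ ℚ) : ℕ :=
  c.support.sup SimpleStatistic.degree

/-- The largest length of a pattern that appears in the linear combination `c`. -/
noncomputable def maxLength (c : SimpleStatistic →₀ ℚ) : ℕ :=
  c.support.sup SimpleStatistic.length

/-- The degree of a statistic `f`: the minimum of `maxDegree c` over all representations `c`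
of `f`. -/
noncomputable def degree (f : (n : ℕ) → SetPartition n → ℚ) : ℕ :=
  sInf {d | ∃ c : SimpleStatistic →₀ ℚ, Represents c f ∧ maxDegree c = d}

/-- The aggregate `M(f; n) = ∑_{l ∈ Π(n)} f(l)`. -/
def aggregate (f : (n : ℕ) → SetPartition n → ℚ) (n : ℕ) : ℚ :=
  ∑ l : SetPartition n, f n l

/-- The Bell number `B_m`, with the convention `B_m = 0` for `m < 0`. -/
def bellNumber (m : ℤ) : ℚ :=
  if 0 ≤ m then (Nat.bell m.toNat : ℚ) else 0

/-- A shifted Bell polynomial `∑_j Q_j(n) B_{n+j}`, given by its finitely supported family of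
coefficient polynomials `Q_j ∈ ℚ[x]`, `j ∈ ℤ`. -/
abbrev ShiftedBellPolynomial : Type := ℤ →₀ Polynomial ℚ

/-- The value `R(n) = ∑_j Q_j(n) B_{n+j}`. -/
noncomputable def evalAt (R : ShiftedBellPolynomial) (n : ℕ) : ℚ :=
  R.sum fun j q => q.eval (n : ℚ) * bellNumber ((n : ℤ) + j)

end SetPartitionStat

/-! Write L for the umbral functional `bellFunctional`, X ^ m ↦ B_m, and (X)_b for the falling
factorial. The Bell recurrence gives L((X)_b q(X)) = L(q(X + b)), in particular L((X)_b) = 1. Hence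
M(f; n) is L applied to ∑_λ f(λ) (X)_{|λ|}, where |λ| is the number of blocks. At X = m this
polynomial is the sum of f(ker φ) over all maps φ : [n] → [m].

Fix a consistent pattern with ℓ blocks and admissible positions x for its entries. The maps φ whose
kernel has an occurrence at x number (m)_ℓ times a factor m - b for every other point, where b ≤ ℓ
counts the pattern blocks which that point must avoid and depends only on its gap
(`card_isOccurrence_kerPartition`). Summing over x with monomial weights is an iterated convolution
of geometric sequences. It yields combinations of C(n - c, s) (X - b) ^ (n - c - s + r) p(X), where
c is the number of forced adjacencies (`placements_mem`). As b ≤ ℓ, a shift by b turns L of (X)_ℓ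
times such a term into C(n - c, s) times a combination of Bell numbers, and the bounds on s, r and
deg p become the bounds on indices and degrees (`exists_boundedBell_of_mem`).

A representation with maximal length k need not attain the degree N. Both sets of bounds hold for
one R because a shifted Bell polynomial is determined by its values at large n
(`evalAt_eq_zero_imp`). This is proved modulo large primes p: L vanishes on the multiples of X ^ p -
X - 1, while no nonzero polynomial of degree less than p has all its multiples in the kernel of L.
-/

namespace SetPartitionStat

open Polynomial

/-! ### The umbral functional of the Bell numbers. -/

section BellFunctional

variable (R : Type*) [CommRing R]

/-- The umbral functional `X ^ n ↦ B_n`. -/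
noncomputable def bellFunctional : R[X] →ₗ[R] R :=
  Polynomial.lsum fun n => (Nat.bell n : R) • LinearMap.id

variable {R}

lemma bellFunctional_monomial (n : ℕ) (a : R) :
    bellFunctional R (monomial n a) = Nat.bell n * a := by
  simp [bellFunctional, Polynomial.lsum_apply, Polynomial.sum_monomial_index]

lemma bellFunctional_X_pow (n : ℕ) : bellFunctional R (X ^ n) = Nat.bell n := by
  rw [X_pow_eq_monomial, bellFunctional_monomial, mul_one]

lemma bellFunctional_one : bellFunctional R 1 = 1 := by
  simpa using bellFunctional_X_pow (R := R) 0

lemma bellFunctional_C_mul (a : R) (q : R[X]) :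
    bellFunctional R (C a * q) = a * bellFunctional R q := by
  rw [← smul_eq_C_mul, map_smul, smul_eq_mul]

lemma bell_succ_eq_sum (n : ℕ) :
    Nat.bell (n + 1) = ∑ i ∈ range (n + 1), n.choose i * Nat.bell i := by
  rw [Nat.bell_succ', ← Finset.Nat.sum_antidiagonal_swap,
    Finset.Nat.sum_antidiagonal_eq_sum_range_succ_mk]
  refine Finset.sum_congr rfl fun i hi => ?_
  simp [Nat.choose_symm (Nat.lt_succ_iff.1 (Finset.mem_range.1 hi))]

/-- The umbral form of the recurrence B_{n+1} = ∑ C(n, i) B_i. -/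
lemma bellFunctional_X_mul (q : R[X]) :
    bellFunctional R (X * q) = bellFunctional R (q.comp (X + 1)) := by
  induction q using Polynomial.induction_on' with
  | add p q hp hq => simp only [mul_add, map_add, add_comp, hp, hq]
  | monomial n a =>
    rw [← C_mul_X_pow_eq_monomial, mul_left_comm, bellFunctional_C_mul, C_mul_comp,
      bellFunctional_C_mul, ← pow_succ', bellFunctional_X_pow, X_pow_comp, add_pow,
      bell_succ_eq_sum, map_sum]
    congr 1
    push_cast
    refine Finset.sum_congr rfl fun i _ => ?_
    rw [one_pow, mul_one, mul_comm (X ^ i), ← C_eq_natCast, bellFunctional_C_mul,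
      bellFunctional_X_pow]

lemma bellFunctional_descPochhammer_mul (b : ℕ) (q : R[X]) :
    bellFunctional R (descPochhammer R b * q) = bellFunctional R (q.comp (X + (b : R[X]))) := by
  induction b generalizing q with
  | zero => simp
  | succ b ih =>
    rw [descPochhammer_succ_left, mul_assoc, bellFunctional_X_mul, mul_comp, comp_assoc]
    have : ((X - 1 : R[X]).comp (X + 1)) = X := by simp
    rw [this, comp_X, ih, comp_assoc]
    congr 2
    simp only [add_comp, X_comp, one_comp]
    push_cast
    ring

lemma bellFunctional_descPochhammer (b : ℕ) :
    bellFunctional R (descPochhammer R b) = 1 := by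
  have := bellFunctional_descPochhammer_mul (R := R) b 1
  rwa [mul_one, one_comp, bellFunctional_one] at this

end BellFunctional

/-! ### Uniqueness of shifted Bell polynomials, by reduction modulo primes. -/

section Uniqueness

variable (p : ℕ) [hp : Fact p.Prime]

/-- Both sides are monic of degree p and vanish on all of `ZMod p`. -/
lemma descPochhammer_zmod_self : descPochhammer (ZMod p) p = X ^ p - X := by
  have hp1 := hp.out.one_lt
  have hdeg : (X ^ p - X : (ZMod p)[X]).natDegree = p :=
    FiniteField.X_pow_card_sub_X_natDegree_eq _ hp1
  have hmon : (X ^ p - X : (ZMod p)[X]).Monic := by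
    apply monic_X_pow_sub
    rw [degree_X]; exact_mod_cast hp1
  refine Polynomial.eq_of_degree_sub_lt_of_eval_finset_eq (s := univ) ?_ ?_
  · have h := degree_sub_lt_left (p := descPochhammer (ZMod p) p) (q := (X ^ p - X : (ZMod p)[X]))
      (by rw [degree_eq_natDegree (monic_descPochhammer _ _).ne_zero,
        degree_eq_natDegree hmon.ne_zero, hdeg, descPochhammer_natDegree])
      (monic_descPochhammer _ _).ne_zero
      (by rw [(monic_descPochhammer _ _).leadingCoeff, hmon.leadingCoeff])
    refine h.trans_le ?_
    rw [degree_eq_natDegree (monic_descPochhammer _ _).ne_zero, descPochhammer_natDegree]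
    simp [ZMod.card]
  · intro a _
    simp only [eval_sub, eval_pow, eval_X, ZMod.pow_card, sub_self]
    rw [← ZMod.natCast_zmod_val a, descPochhammer_eval_eq_descFactorial,
      Nat.descFactorial_eq_zero_iff_lt.2 (ZMod.val_lt a), Nat.cast_zero]

/-- Touchard's congruence: multiplying by (X)_p = X ^ p - X amounts under L to the shift by p, which
is trivial modulo p. -/
lemma bellFunctional_zmod_mul (q : (ZMod p)[X]) :
    bellFunctional (ZMod p) (q * (X ^ p - X - 1)) = 0 := by
  have h := bellFunctional_descPochhammer_mul (R := ZMod p) p q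
  rw [descPochhammer_zmod_self, CharP.cast_eq_zero, add_zero, comp_X] at h
  rw [mul_comm, sub_mul, one_mul, map_sub, h, sub_self]

/-- The polynomials `q` with `L(q r) = 0` for all `r`, where `L` is the umbral functional. -/
noncomputable def bellIdeal : Ideal (ZMod p)[X] where
  carrier := {q | ∀ r, bellFunctional (ZMod p) (q * r) = 0}
  add_mem' ha hb r := by rw [add_mul, map_add, ha r, hb r, add_zero]
  zero_mem' r := by simp
  smul_mem' a q hq r := by rw [smul_eq_mul, mul_assoc, mul_left_comm]; exact hq _

lemma artinSchreier_mem_bellIdeal : (X ^ p - X - 1 : (ZMod p)[X]) ∈ bellIdeal p := fun r => by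
  rw [mul_comm]; exact bellFunctional_zmod_mul p r

lemma comp_sub_comp_mem_bellIdeal (q : (ZMod p)[X]) :
    q.comp (X ^ p) - q.comp (X + 1) ∈ bellIdeal p := by
  refine Ideal.mem_of_dvd _ ?_ (artinSchreier_mem_bellIdeal p)
  rw [sub_sub]
  simp only [comp, eval₂_eq_eval_map]
  exact sub_dvd_eval_sub _ _ _

/-- Modulo the ideal X + 1 is X ^ p, and q(X ^ p) = q(X) ^ p by Frobenius. -/
lemma comp_mem_bellIdeal {q : (ZMod p)[X]} (hq : q ∈ bellIdeal p) :
    q.comp (X + 1) ∈ bellIdeal p := by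
  have h1 : q.comp (X ^ p) ∈ bellIdeal p := by
    rw [← expand_eq_comp_X_pow, ZMod.expand_card]
    exact Ideal.pow_mem_of_mem _ hq _ hp.out.pos
  simpa using sub_mem h1 (comp_sub_comp_mem_bellIdeal p q)

lemma eq_zero_of_mem_bellIdeal {q : (ZMod p)[X]} (hq : q ∈ bellIdeal p) (hd : q.natDegree < p) :
    q = 0 := by
  by_contra h0
  obtain ⟨g, hg⟩ := (IsPrincipalIdealRing.principal (bellIdeal p)).principal
  have hgm : g ∈ bellIdeal p := by rw [hg]; exact Submodule.mem_span_singleton_self g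
  have hdvd : ∀ r ∈ bellIdeal p, g ∣ r := fun r hr => by
    rw [hg] at hr; exact Ideal.mem_span_singleton.1 hr
  have hg0 : g ≠ 0 := by
    rintro rfl
    exact h0 (zero_dvd_iff.1 (hdvd q hq))
  have hgd : g.natDegree < p := (natDegree_le_of_dvd (hdvd q hq) h0).trans_lt hd
  have hmX : (X + 1 : (ZMod p)[X]).natDegree = 1 := by simpa using natDegree_X_add_C (1 : ZMod p)
  -- The generator `g` divides its shift, which has the same degree and leading coefficient, so the
  -- quotient is 1.
  have hcomp : g.comp (X + 1) = g := by
    obtain ⟨u, hu⟩ := hdvd _ (comp_mem_bellIdeal p hgm)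
    have hlc : (g.comp (X + 1)).leadingCoeff = g.leadingCoeff := by
      rw [leadingCoeff_comp (by rw [hmX]; exact one_ne_zero)]
      have : (X + 1 : (ZMod p)[X]).leadingCoeff = 1 := by
        simpa using leadingCoeff_X_add_C (1 : ZMod p)
      rw [this, one_pow, mul_one]
    have hu0 : u ≠ 0 := by
      rintro rfl
      rw [hu, mul_zero, leadingCoeff_zero] at hlc
      exact hg0 (leadingCoeff_eq_zero.1 hlc.symm)
    have hud : u.natDegree = 0 := by
      have h2 := natDegree_comp (p := g) (q := X + 1)
      rw [hmX, mul_one, hu, natDegree_mul hg0 hu0] at h2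
      omega
    rw [eq_C_of_natDegree_eq_zero hud] at hu
    rw [hu, leadingCoeff_mul, leadingCoeff_C] at hlc
    rw [hu, mul_right_eq_self₀.1 hlc |>.resolve_right (by simpa using hg0), C_1, mul_one]
  have hev : ∀ n : ℕ, g.eval (n : ZMod p) = g.eval 0 := by
    intro n
    induction n with
    | zero => simp
    | succ n ih =>
      rw [← ih]
      conv_rhs => rw [← hcomp]
      simp
  -- Shift invariance makes `g` constant on `ZMod p`, and its degree is less than p. A nonzero
  -- constant in the ideal contradicts L(1) = 1.
  have hconst : g = C (g.eval 0) := by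
    refine Polynomial.eq_of_degree_sub_lt_of_eval_finset_eq (s := univ) ?_ ?_
    · refine (degree_sub_le _ _).trans_lt (max_lt ?_ ?_)
      · rw [degree_eq_natDegree hg0]; simpa [ZMod.card] using hgd
      · refine degree_C_le.trans_lt ?_
        simpa [ZMod.card] using hp.out.pos
    · intro a _
      rw [← ZMod.natCast_zmod_val a, hev, eval_C]
  have hc0 : g.eval 0 ≠ 0 := fun h => hg0 (by rw [hconst, h, C_0])
  have h1 := hgm (C (g.eval 0)⁻¹)
  rw [hconst, eval_C, ← C_mul, mul_inv_cancel₀ hc0, C_1, bellFunctional_one] at h1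
  exact one_ne_zero h1

end Uniqueness

lemma int_coeff_eq_zero_of_bell_relation (I : ℕ) (S : ℕ → ℤ[X])
    (h : ∀ t : ℕ, ∑ i ∈ range I, (S i).eval (t : ℤ) * (Nat.bell (t + i) : ℤ) = 0) :
    ∀ i ∈ range I, S i = 0 := by
  have key : ∀ i ∈ range I, ∀ t : ℕ, (S i).eval (t : ℤ) = 0 := by
    intro i hi t
    by_contra hne
    -- The prime exceeds both the degree of `g` below and the absolute value of the coefficient to
    -- be shown zero.
    obtain ⟨p, hpge, hpp⟩ := Nat.exists_infinite_primes (t + I + ((S i).eval (t : ℤ)).natAbs + 1)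
    have : Fact p.Prime := ⟨hpp⟩
    set g : (ZMod p)[X] := ∑ i ∈ range I, C (((S i).eval (t : ℤ) : ℤ) : ZMod p) * X ^ (t + i) with hg
    -- This is the relation at t + p * s, whose polynomial coefficients agree modulo p with those at
    -- t.
    have hgX : ∀ s : ℕ, bellFunctional (ZMod p) (g * X ^ (p * s)) = 0 := by
      intro s
      have h1 := congrArg (Int.cast : ℤ → ZMod p) (h (t + p * s))
      rw [hg, Finset.sum_mul, map_sum]
      push_cast at h1
      rw [← h1]
      refine Finset.sum_congr rfl fun j _ => ?_
      rw [mul_assoc, bellFunctional_C_mul, ← pow_add, bellFunctional_X_pow,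
        show t + j + p * s = t + p * s + j by ring]
      congr 1
      have h2 : ∀ z : ℤ, (((S j).eval z : ℤ) : ZMod p)
          = ((S j).map (Int.castRingHom (ZMod p))).eval (z : ZMod p) := by
        intro z
        simp
      have h3 := h2 ((t : ℤ) + (p : ℤ) * (s : ℤ))
      rw [h2, h3]
      simp
    have hmem : g ∈ bellIdeal p := by
      have h1 : ∀ q : (ZMod p)[X], bellFunctional (ZMod p) (g * q.comp (X ^ p)) = 0 := by
        intro q
        induction q using Polynomial.induction_on' with
        | add a b ha hb => rw [add_comp, mul_add, map_add, ha, hb, add_zero]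
        | monomial n a =>
          rw [← C_mul_X_pow_eq_monomial, C_mul_comp, X_pow_comp, mul_left_comm,
            bellFunctional_C_mul, ← pow_mul, hgX, mul_zero]
      intro r
      -- Since X ^ p is X + 1 modulo the ideal, every `r` is congruent to a polynomial in X ^ p,
      -- namely r(X ^ p - 1).
      have h2 := comp_sub_comp_mem_bellIdeal p (r.comp (X - 1)) g
      have h3 : (r.comp (X - 1)).comp (X + 1) = r := by
        rw [comp_assoc]; simp
      rw [h3, sub_mul, map_sub, mul_comm, h1, zero_sub, neg_eq_zero, mul_comm] at h2
      exact h2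
    have hdeg : g.natDegree < p := by
      refine (natDegree_sum_le_of_forall_le (n := t + I) _ _ fun j hj => ?_).trans_lt (by omega)
      refine (natDegree_C_mul_X_pow_le _ _).trans ?_
      have := Finset.mem_range.1 hj
      omega
    have hg0 := eq_zero_of_mem_bellIdeal p hmem hdeg
    have hco := congrArg (fun q => coeff q (t + i)) hg0
    simp only [hg, finsetSum_coeff, coeff_C_mul, coeff_X_pow, coeff_zero] at hco
    rw [Finset.sum_eq_single i (fun j _ hj => by simp [Ne.symm hj]) (fun h => absurd hi h)] at hco
    simp only [if_true, mul_one] at hco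
    rw [ZMod.intCast_zmod_eq_zero_iff_dvd] at hco
    have := Nat.le_of_dvd (Int.natAbs_pos.2 hne) (Int.natCast_dvd.1 hco)
    omega
  intro i hi
  refine Polynomial.eq_zero_of_infinite_isRoot _ ?_
  refine (Set.infinite_range_of_injective (Nat.cast_injective (R := ℤ))).mono ?_
  rintro _ ⟨t, rfl⟩
  exact key i hi t

lemma exists_common_denominator (I : ℕ) (S : ℕ → ℚ[X]) :
    ∃ (N : ℤ) (T : ℕ → ℤ[X]), N ≠ 0 ∧
      ∀ i ∈ range I, (T i).map (Int.castRingHom ℚ) = C (N : ℚ) * S i := by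
  induction I with
  | zero => exact ⟨1, fun _ => 0, one_ne_zero, by simp⟩
  | succ I ih =>
    obtain ⟨N, T, hN, hT⟩ := ih
    obtain ⟨b, hbm, hb⟩ := IsLocalization.integerNormalization_spec (nonZeroDivisors ℤ) (S I)
    refine ⟨N * b, fun i => if i = I then C N * IsLocalization.integerNormalization (nonZeroDivisors ℤ) (S I)
      else C b * T i, mul_ne_zero hN (nonZeroDivisors.ne_zero hbm), fun i hi => ?_⟩
    by_cases h : i = I
    · subst h
      have hb' : Polynomial.map (Int.castRingHom ℚ)
          (IsLocalization.integerNormalization (nonZeroDivisors ℤ) (S i)) = C (b : ℚ) * S i := by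
        simpa [zsmul_eq_mul] using hb
      simp only [if_true, Polynomial.map_mul, hb', map_C, Int.coe_castRingHom]
      rw [Int.cast_mul, C_mul]; ring
    · have hi' : i ∈ range I := by
        rw [Finset.mem_range] at *; omega
      simp only [if_neg h, Polynomial.map_mul, hT i hi', map_C, Int.coe_castRingHom]
      rw [Int.cast_mul, C_mul]; ring

lemma coeff_eq_zero_of_bell_relation (I : ℕ) (S : ℕ → ℚ[X])
    (h : ∀ t : ℕ, ∑ i ∈ range I, (S i).eval (t : ℚ) * (Nat.bell (t + i) : ℚ) = 0) :
    ∀ i ∈ range I, S i = 0 := by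
  obtain ⟨N, T, hN, hT⟩ := exists_common_denominator I S
  have hT0 := int_coeff_eq_zero_of_bell_relation I T fun t => by
    have : ((∑ i ∈ range I, (T i).eval (t : ℤ) * (Nat.bell (t + i) : ℤ) : ℤ) : ℚ) = 0 := by
      push_cast
      rw [← mul_zero (N : ℚ), ← h t, Finset.mul_sum]
      refine Finset.sum_congr rfl fun i hi => ?_
      have h1 : (((T i).eval (t : ℤ) : ℤ) : ℚ) = ((T i).map (Int.castRingHom ℚ)).eval (t : ℚ) := by
        simp
      rw [h1, hT i hi, eval_mul, eval_C]
      ring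
    exact_mod_cast this
  intro i hi
  have h1 := hT i hi
  rw [hT0 i hi, Polynomial.map_zero] at h1
  exact (mul_eq_zero.1 h1.symm).resolve_left (by simpa using hN)

lemma evalAt_eq_zero_imp (R : ShiftedBellPolynomial) (n₀ : ℕ)
    (h : ∀ n ≥ n₀, evalAt R n = 0) : R = 0 := by
  obtain ⟨a, ha⟩ : ∃ a : ℕ, ∀ j ∈ R.support, j.natAbs < a := by
    refine ⟨R.support.sup Int.natAbs + 1, fun j hj => Nat.lt_succ_of_le ?_⟩
    exact Finset.le_sup (f := Int.natAbs) hj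
  -- Substituting n = t + n₁ makes the relation valid for all t ≥ 0 and moves every index j to i = j
  -- + n₁ ≥ 0.
  set n₁ := n₀ + a
  set S : ℕ → ℚ[X] := fun i => (R ((i : ℤ) - n₁)).comp (X + (n₁ : ℚ[X])) with hS
  have hrel : ∀ t : ℕ, ∑ i ∈ range (n₁ + a), (S i).eval (t : ℚ) * (Nat.bell (t + i) : ℚ) = 0 := by
    intro t
    have h1 := h (t + n₁) (by omega)
    rw [evalAt, Finsupp.sum] at h1
    rw [← h1]
    symm
    refine Finset.sum_of_injOn (fun j => (j + n₁).toNat) ?_ ?_ ?_ ?_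
    · intro j hj j' hj' hjj
      have := ha j hj; have := ha j' hj'
      simp only at hjj; omega
    · intro j hj
      have := ha j hj
      simp only [coe_range, Set.mem_Iio]; omega
    · intro i _ hi'
      have : R ((i : ℤ) - n₁) = 0 := by
        by_contra hne
        refine hi' ⟨(i : ℤ) - n₁, ?_, ?_⟩
        · simpa using hne
        · simp
      simp [hS, this]
    · intro j hj
      have := ha j hj
      have h2 : (((j + n₁).toNat : ℕ) : ℤ) - n₁ = j := by omega
      have h3 : t + (j + n₁).toNat = (((t + n₁ : ℕ) : ℤ) + j).toNat := by omega
      simp only [hS, h2, h3, eval_comp, bellNumber]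
      rw [if_pos (by omega)]
      simp
  have hz := coeff_eq_zero_of_bell_relation _ S hrel
  ext1 j
  by_contra hne
  have hj : j ∈ R.support := by simpa using hne
  have hja := ha j hj
  have h2 := hz (j + n₁).toNat (by rw [Finset.mem_range]; omega)
  have h3 : (((j + n₁).toNat : ℕ) : ℤ) - n₁ = j := by omega
  simp only [hS, h3] at h2
  rw [← C_eq_natCast, comp_X_add_C_eq_zero_iff] at h2
  exact hne (by simpa using h2)

/-! ### Binomial-geometric sequences and their convolutions. -/

/-- The sequence `n ↦ C(n, s) (X - b) ^ (n - s + r) p`. -/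
noncomputable def chooseGeom (b s r : ℕ) (p : ℚ[X]) (n : ℕ) : ℚ[X] :=
  (n.choose s : ℚ[X]) * (X - (b : ℚ[X])) ^ (n - s + r) * p

/-- The span of the sequences `chooseGeom b s r p` with `b ≤ l`, `s ≤ K + r` and
`r + natDegree p ≤ T`. -/
noncomputable def chooseGeomSpan (l K T : ℕ) : Submodule ℚ (ℕ → ℚ[X]) :=
  Submodule.span ℚ {S | ∃ b s r p, b ≤ l ∧ s ≤ K + r ∧ r + p.natDegree ≤ T ∧ S = chooseGeom b s r p}

/-- The sequence `n ↦ ∑_{y < n} S(y) (X - b) ^ (n - 1 - y)`. -/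
noncomputable def geomConv (b : ℕ) (S : ℕ → ℚ[X]) (n : ℕ) : ℚ[X] :=
  ∑ y ∈ range n, S y * (X - (b : ℚ[X])) ^ (n - 1 - y)

lemma geomConv_succ (b : ℕ) (S : ℕ → ℚ[X]) (n : ℕ) :
    geomConv b S (n + 1) = (X - (b : ℚ[X])) * geomConv b S n + S n := by
  simp only [geomConv, Finset.sum_range_succ, Finset.mul_sum]
  congr 1
  · refine Finset.sum_congr rfl fun y hy => ?_
    have := Finset.mem_range.1 hy
    rw [show n + 1 - 1 - y = (n - 1 - y) + 1 by omega, pow_succ]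
    ring
  · simp

/-- The convolution is the only solution of this first-order recurrence, so a closed form for it
need only be checked against the recurrence. -/
lemma eq_geomConv {b : ℕ} {S T : ℕ → ℚ[X]} (h0 : T 0 = 0)
    (h : ∀ n, T (n + 1) = (X - (b : ℚ[X])) * T n + S n) : geomConv b S = T := by
  funext n
  induction n with
  | zero => simp [geomConv, h0]
  | succ n ih => rw [geomConv_succ, h, ih]

lemma chooseGeom_mem {l K T b s r : ℕ} {p : ℚ[X]} (hb : b ≤ l) (hs : s ≤ K + r)
    (hr : r + p.natDegree ≤ T) : chooseGeom b s r p ∈ chooseGeomSpan l K T :=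
  Submodule.subset_span ⟨b, s, r, p, hb, hs, hr, rfl⟩

lemma chooseGeom_succ_succ (b s r : ℕ) (p : ℚ[X]) (n : ℕ) :
    chooseGeom b (s + 1) r p (n + 1)
      = (X - (b : ℚ[X])) * chooseGeom b (s + 1) r p n + chooseGeom b s r p n := by
  simp only [chooseGeom, Nat.choose_succ_succ, Nat.cast_add, Nat.succ_eq_add_one,
    Nat.add_sub_add_right]
  rcases lt_or_ge n (s + 1) with h | h
  · rw [Nat.choose_eq_zero_of_lt h]; simp
  · rw [show n - s + r = (n - (s + 1) + r) + 1 by omega, pow_succ]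
    ring

lemma geomConv_chooseGeom_self (b s r : ℕ) (p : ℚ[X]) :
    geomConv b (chooseGeom b s r p) = chooseGeom b (s + 1) r p :=
  eq_geomConv (by simp [chooseGeom]) (chooseGeom_succ_succ b s r p)

/-- A geometric sum: (X - a) - (X - b) = b - a is an invertible constant, so no denominator in X
arises. -/
lemma geomConv_chooseGeom_zero {a b : ℕ} (hab : a ≠ b) (r : ℕ) (p : ℚ[X]) :
    geomConv b (chooseGeom a 0 r p) = ((b : ℚ) - a)⁻¹ •
      (chooseGeom a 0 r p - chooseGeom b 0 0 ((X - (a : ℚ[X])) ^ r * p)) := by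
  have hne : ((b : ℚ) - a) ≠ 0 := sub_ne_zero.2 (by exact_mod_cast hab.symm)
  have hC : C ((b : ℚ) - a)⁻¹ * ((b : ℚ[X]) - a) = 1 := by
    rw [← C_eq_natCast, ← C_eq_natCast, ← C_sub, ← C_mul, inv_mul_cancel₀ hne, C_1]
  refine eq_geomConv ?_ fun n => ?_
  · simp [chooseGeom]
  · simp only [Pi.smul_apply, Pi.sub_apply, smul_eq_C_mul, chooseGeom, Nat.choose_zero_right,
      Nat.sub_zero, Nat.cast_one, pow_add, pow_succ, pow_zero]
    linear_combination ((X - (a : ℚ[X])) ^ n * (X - (a : ℚ[X])) ^ r * p) * hC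

lemma geomConv_chooseGeom_succ {a b : ℕ} (hab : a ≠ b) (s r : ℕ) (p : ℚ[X]) :
    geomConv b (chooseGeom a (s + 1) r p) = ((b : ℚ) - a)⁻¹ •
      (chooseGeom a (s + 1) r p - geomConv b (chooseGeom a s r p)) := by
  have hne : ((b : ℚ) - a) ≠ 0 := sub_ne_zero.2 (by exact_mod_cast hab.symm)
  have hC : C ((b : ℚ) - a)⁻¹ * ((b : ℚ[X]) - a) = 1 := by
    rw [← C_eq_natCast, ← C_eq_natCast, ← C_sub, ← C_mul, inv_mul_cancel₀ hne, C_1]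
  refine eq_geomConv ?_ fun n => ?_
  · simp [chooseGeom, geomConv]
  · simp only [Pi.smul_apply, Pi.sub_apply, smul_eq_C_mul, chooseGeom_succ_succ, geomConv_succ]
    linear_combination (chooseGeom a (s + 1) r p n) * hC

lemma geomConv_add (b : ℕ) (S S' : ℕ → ℚ[X]) :
    geomConv b (S + S') = geomConv b S + geomConv b S' := by
  funext n; simp [geomConv, add_mul, Finset.sum_add_distrib]

lemma geomConv_smul (b : ℕ) (a : ℚ) (S : ℕ → ℚ[X]) :
    geomConv b (a • S) = a • geomConv b S := by
  funext n; simp [geomConv, Finset.smul_sum]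

lemma natDegree_X_sub_natCast_pow_mul_le (a r : ℕ) (p : ℚ[X]) :
    ((X - (a : ℚ[X])) ^ r * p).natDegree ≤ r + p.natDegree := by
  refine natDegree_mul_le.trans (Nat.add_le_add_right ?_ _)
  refine natDegree_pow_le.trans ?_
  rw [← C_eq_natCast, natDegree_X_sub_C, mul_one]

/-- Equal bases raise s by one; for different bases s is lowered recursively down to a geometric
sum. -/
lemma geomConv_mem {l K T b : ℕ} (hb : b ≤ l) {S : ℕ → ℚ[X]} (hS : S ∈ chooseGeomSpan l K T) :
    geomConv b S ∈ chooseGeomSpan l (K + 1) T := by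
  induction hS using Submodule.span_induction with
  | zero =>
    have : geomConv b 0 = 0 := by funext n; simp [geomConv]
    rw [this]; exact zero_mem _
  | add S S' _ _ h h' => rw [geomConv_add]; exact add_mem h h'
  | smul a S _ h => rw [geomConv_smul]; exact Submodule.smul_mem _ _ h
  | mem S hS =>
    obtain ⟨a, s, r, p, ha, hs, hr, rfl⟩ := hS
    by_cases hab : a = b
    · subst hab
      rw [geomConv_chooseGeom_self]
      exact chooseGeom_mem ha (by omega) hr
    · induction s with
      | zero =>
        rw [geomConv_chooseGeom_zero hab]
        refine Submodule.smul_mem _ _ (sub_mem (chooseGeom_mem ha (by omega) hr)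
          (chooseGeom_mem hb (by omega) ?_))
        have := natDegree_X_sub_natCast_pow_mul_le a r p
        omega
      | succ s ih =>
        rw [geomConv_chooseGeom_succ hab]
        exact Submodule.smul_mem _ _ (sub_mem (chooseGeom_mem ha (by omega) hr) (ih (by omega)))

lemma chooseGeomSpan_mono {l K K' T T' : ℕ} (hK : K ≤ K') (hT : T ≤ T') :
    chooseGeomSpan l K T ≤ chooseGeomSpan l K' T' := by
  refine Submodule.span_mono ?_
  rintro S ⟨b, s, r, p, hb, hs, hr, rfl⟩
  exact ⟨b, s, r, p, hb, by omega, by omega, rfl⟩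

/-- Multiplication by n raises s and r together, or neither. This is why the bound in
`chooseGeomSpan` is s ≤ K + r, with K unaffected by polynomial weights. -/
lemma natCast_mul_chooseGeom (b s r : ℕ) (p : ℚ[X]) :
    (fun n : ℕ => (n : ℚ[X]) * chooseGeom b s r p n)
      = ((s + 1 : ℕ) : ℚ) • chooseGeom b (s + 1) (r + 1) p + (s : ℚ) • chooseGeom b s r p := by
  funext n
  have h : n * n.choose s = (s + 1) * n.choose (s + 1) + s * n.choose s := by
    rcases lt_or_ge n s with h | h
    · rw [Nat.choose_eq_zero_of_lt h, Nat.choose_eq_zero_of_lt (by omega)]; simp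
    · have h1 := Nat.choose_succ_right_eq n s
      obtain ⟨m, rfl⟩ := Nat.exists_eq_add_of_le h
      rw [Nat.add_sub_cancel_left] at h1
      linarith
  have h' : (n : ℚ[X]) * (n.choose s : ℚ[X])
      = ((s : ℚ[X]) + 1) * n.choose (s + 1) + s * n.choose s := by exact_mod_cast h
  simp only [Pi.add_apply, Pi.smul_apply, smul_eq_C_mul, C_eq_natCast, chooseGeom]
  push_cast
  rcases lt_or_ge n (s + 1) with hn | hn
  · rw [Nat.choose_eq_zero_of_lt hn] at h' ⊢
    linear_combination ((X - (b : ℚ[X])) ^ (n - s + r) * p) * h'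
  · rw [show n - (s + 1) + (r + 1) = n - s + r by omega]
    linear_combination ((X - (b : ℚ[X])) ^ (n - s + r) * p) * h'

lemma natCast_mul_mem {l K T : ℕ} {S : ℕ → ℚ[X]} (hS : S ∈ chooseGeomSpan l K T) :
    (fun n : ℕ => (n : ℚ[X]) * S n) ∈ chooseGeomSpan l K (T + 1) := by
  induction hS using Submodule.span_induction with
  | zero =>
    simp only [Pi.zero_apply, mul_zero]
    exact zero_mem _
  | add S S' _ _ h h' =>
    simp only [Pi.add_apply, mul_add]
    exact add_mem h h'
  | smul a S _ h =>
    simp only [Pi.smul_apply, mul_smul_comm]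
    exact Submodule.smul_mem _ a h
  | mem S hS =>
    obtain ⟨a, s, r, p, ha, hs, hr, rfl⟩ := hS
    rw [natCast_mul_chooseGeom]
    exact add_mem (Submodule.smul_mem _ _ (chooseGeom_mem ha (by omega) (by omega)))
      (Submodule.smul_mem _ _ (chooseGeom_mem ha (by omega) (by omega)))

lemma natCast_add_pow_mul_mem {l K T : ℕ} {S : ℕ → ℚ[X]} (hS : S ∈ chooseGeomSpan l K T)
    (a e : ℕ) : (fun n : ℕ => ((n + a : ℕ) : ℚ[X]) ^ e * S n) ∈ chooseGeomSpan l K (T + e) := by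
  induction e with
  | zero => simpa using hS
  | succ e ih =>
    have h1 := natCast_mul_mem ih
    have h2 := Submodule.smul_mem _ (a : ℚ) (chooseGeomSpan_mono le_rfl (Nat.le_succ (T + e)) ih)
    refine (congrArg (· ∈ chooseGeomSpan l K (T + (e + 1))) ?_).mp (add_mem h1 h2)
    funext n
    simp only [Pi.add_apply, Pi.smul_apply, smul_eq_C_mul, C_eq_natCast, pow_succ]
    push_cast
    ring

/-! ### Generating polynomials of weighted placements. -/

/-- The generating polynomial of the tuples `x_0 < ⋯ < x_i = y` with `x_j = x_{j-1} + 1` for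
`j ∈ J`, each with the weight `∏_j (x_j + 1) ^ (d j)` and a factor `X - b j` for each point strictly
between `x_{j-1}` and `x_j`. -/
noncomputable def placementsEndingAt (d b : ℕ → ℕ) (J : Finset ℕ) : ℕ → ℕ → ℚ[X]
  | 0, y => ((y + 1 : ℕ) : ℚ[X]) ^ d 0 * (X - (b 0 : ℚ[X])) ^ y
  | i + 1, y => ((y + 1 : ℕ) : ℚ[X]) ^ d (i + 1) *
      if i + 1 ∈ J then (if y = 0 then 0 else placementsEndingAt d b J i (y - 1))
      else geomConv (b (i + 1)) (placementsEndingAt d b J i) y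

/-- The generating polynomial of the tuples `x_0 < ⋯ < x_{k-1} < n`, weighted as in
`placementsEndingAt`. -/
noncomputable def placements (d b : ℕ → ℕ) (J : Finset ℕ) : ℕ → ℕ → ℚ[X]
  | 0, n => (X - (b 0 : ℚ[X])) ^ n
  | k + 1, n => geomConv (b (k + 1)) (placementsEndingAt d b J k) n

lemma geomConv_shift {c : ℕ} {S : ℕ → ℚ[X]} (hS : ∀ y < c, S y = 0) (b m : ℕ) :
    geomConv b S (m + c) = geomConv b (fun y => S (y + c)) m := by
  simp only [geomConv]
  rw [add_comm m c, Finset.sum_range_add, Finset.sum_eq_zero (s := range c), zero_add]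
  · refine Finset.sum_congr rfl fun y _ => ?_
    rw [add_comm c y, show c + m - 1 - (y + c) = m - 1 - y by omega]
  · intro y hy
    rw [hS y (Finset.mem_range.1 hy), zero_mul]

lemma pow_mem_chooseGeomSpan {l b : ℕ} (hb : b ≤ l) :
    (fun n : ℕ => (X - (b : ℚ[X])) ^ n) ∈ chooseGeomSpan l 0 0 := by
  have : (fun n : ℕ => (X - (b : ℚ[X])) ^ n) = chooseGeom b 0 0 1 := by
    funext n; simp [chooseGeom]
  rw [this]
  exact chooseGeom_mem hb (by simp) (by simp)

/-- Here c counts the forced adjacencies up to i. Each of them is a pure shift of the sequence,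
while each free step is a convolution and costs one unit of K. -/
lemma placementsEndingAt_mem {l : ℕ} (d b : ℕ → ℕ) (J : Finset ℕ) (hb : ∀ i, b i ≤ l) (i : ℕ) :
    ∃ c ≤ i, (∀ y < c, placementsEndingAt d b J i y = 0) ∧
      (fun m => placementsEndingAt d b J i (m + c))
        ∈ chooseGeomSpan l (i - c) (∑ j ∈ range (i + 1), d j) := by
  induction i with
  | zero =>
    refine ⟨0, le_rfl, by simp, ?_⟩
    simpa [placementsEndingAt] using
      natCast_add_pow_mul_mem (pow_mem_chooseGeomSpan (hb 0)) 1 (d 0)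
  | succ i ih =>
    obtain ⟨c, hc, hz, hm⟩ := ih
    rw [Finset.sum_range_succ _ (i + 1)]
    by_cases hJ : i + 1 ∈ J
    · refine ⟨c + 1, by omega, fun y hy => ?_, ?_⟩
      · simp only [placementsEndingAt, if_pos hJ]
        split_ifs with h0
        · simp
        · rw [hz _ (by omega), mul_zero]
      -- The new entry is y = m + c + 1, and its weight is a power of y + 1.
      · have := natCast_add_pow_mul_mem hm (c + 2) (d (i + 1))
        rw [show i + 1 - (c + 1) = i - c by omega]
        simpa only [placementsEndingAt, if_pos hJ, ← add_assoc, Nat.succ_ne_zero, if_false,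
          Nat.add_sub_cancel] using this
    · refine ⟨c, by omega, fun y hy => ?_, ?_⟩
      · simp only [placementsEndingAt, if_neg hJ]
        rw [geomConv, Finset.sum_eq_zero, mul_zero]
        intro z hz'
        rw [hz z ((Finset.mem_range.1 hz').trans hy), zero_mul]
      · have := natCast_add_pow_mul_mem (geomConv_mem (hb (i + 1)) hm) (c + 1) (d (i + 1))
        rw [show i + 1 - c = i - c + 1 by omega]
        simpa [placementsEndingAt, if_neg hJ, ← add_assoc, geomConv_shift hz] using this

lemma placements_mem {l : ℕ} (d b : ℕ → ℕ) (J : Finset ℕ) (hb : ∀ i, b i ≤ l) (k : ℕ) :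
    ∃ c ≤ k - 1, (fun m => placements d b J k (m + c))
        ∈ chooseGeomSpan l (k - c) (∑ j ∈ range k, d j) := by
  cases k with
  | zero => exact ⟨0, le_rfl, by simpa [placements] using pow_mem_chooseGeomSpan (hb 0)⟩
  | succ i =>
    obtain ⟨c, hc, hz, hm⟩ := placementsEndingAt_mem d b J hb i
    refine ⟨c, by omega, ?_⟩
    rw [show i + 1 - c = i - c + 1 by omega]
    simpa only [placements, geomConv_shift hz] using geomConv_mem (hb (i + 1)) hm

/-! ### From binomial-geometric sequences to shifted Bell polynomials. -/

section ShiftedBell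

/-- The coefficients that are admitted at `B_{n+j}` for pattern length `k` and degree `D`. -/
noncomputable def coeffBound (k D : ℕ) (j : ℤ) : Submodule ℚ ℚ[X] :=
  if j < -k then ⊥ else degreeLT ℚ (D - j + if j < 0 then 0 else 1).toNat

/-- The shifted Bell polynomials that satisfy the bounds for pattern length `k` and degree `D`. -/
noncomputable def boundedBell (k D : ℕ) : Submodule ℚ ShiftedBellPolynomial :=
  ⨅ j, (coeffBound k D j).comap (Finsupp.lapply j)

lemma mem_boundedBell {k D : ℕ} {R : ShiftedBellPolynomial} :
    R ∈ boundedBell k D ↔ ∀ j, R j ∈ coeffBound k D j := by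
  simp [boundedBell, Submodule.mem_iInf]

lemma coeffBound_mono {k k' D D' : ℕ} (hk : k ≤ k') (hD : D ≤ D') (j : ℤ) :
    coeffBound k D j ≤ coeffBound k' D' j := by
  unfold coeffBound
  by_cases h : j < -k
  · rw [if_pos h]; exact bot_le
  · have h' : ¬ j < -(k' : ℤ) := by omega
    simp only [h, h', if_false]
    exact degreeLT_mono (by omega)

lemma boundedBell_mono {k k' D D' : ℕ} (hk : k ≤ k') (hD : D ≤ D') :
    boundedBell k D ≤ boundedBell k' D' := fun R hR => by
  rw [mem_boundedBell] at *
  exact fun j => coeffBound_mono hk hD j (hR j)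

lemma single_mem_boundedBell {k D : ℕ} {j : ℤ} {q : ℚ[X]} {s : ℕ} (hq : q.natDegree ≤ s)
    (hj : -(k : ℤ) ≤ j) (hD : j + s ≤ D) (hneg : j < 0 → j + s < D) :
    Finsupp.single j q ∈ boundedBell k D := by
  classical
  rw [mem_boundedBell]
  intro i
  rw [Finsupp.single_apply]
  split_ifs with h
  · subst h
    rw [coeffBound, if_neg (by omega), mem_degreeLT]
    refine degree_le_natDegree.trans_lt ?_
    split_ifs with h0
    · have := hneg h0
      exact_mod_cast (show q.natDegree < (D - j + 0).toNat by omega)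
    · exact_mod_cast (show q.natDegree < (D - j + 1).toNat by omega)
  · exact zero_mem _

lemma evalAt_single (j : ℤ) (q : ℚ[X]) (n : ℕ) :
    evalAt (Finsupp.single j q) n = q.eval (n : ℚ) * bellNumber (n + j) := by
  rw [evalAt, Finsupp.sum_single_index (by simp)]

lemma evalAt_add (R R' : ShiftedBellPolynomial) (n : ℕ) :
    evalAt (R + R') n = evalAt R n + evalAt R' n := by
  classical
  rw [evalAt, Finsupp.sum_add_index (by simp) (by intros; rw [eval_add, add_mul])]
  rfl

lemma evalAt_smul (a : ℚ) (R : ShiftedBellPolynomial) (n : ℕ) :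
    evalAt (a • R) n = a * evalAt R n := by
  rw [evalAt, Finsupp.sum_smul_index' (by simp), evalAt, Finsupp.mul_sum]
  simp [mul_assoc]

lemma evalAt_sum {ι : Type*} (s : Finset ι) (R : ι → ShiftedBellPolynomial) (n : ℕ) :
    evalAt (∑ i ∈ s, R i) n = ∑ i ∈ s, evalAt (R i) n := by
  classical
  induction s using Finset.induction_on with
  | empty => simp [evalAt]
  | insert a s ha ih => rw [Finset.sum_insert ha, Finset.sum_insert ha, evalAt_add, ih]

/-- The polynomial whose value at `n ≥ c` is `C(n - c, s)`. -/
noncomputable def choosePoly (c s : ℕ) : ℚ[X] :=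
  C ((s.factorial : ℚ)⁻¹) * (descPochhammer ℚ s).comp (X - (c : ℚ[X]))

lemma choosePoly_eval {c n : ℕ} (h : c ≤ n) (s : ℕ) :
    (choosePoly c s).eval (n : ℚ) = ((n - c).choose s : ℚ) := by
  have hn : (n : ℚ) - c = ((n - c : ℕ) : ℚ) := by rw [Nat.cast_sub h]
  simp only [choosePoly, eval_mul, eval_C, eval_comp, eval_sub, eval_X, eval_natCast, hn,
    descPochhammer_eval_eq_descFactorial, Nat.descFactorial_eq_factorial_mul_choose, Nat.cast_mul]
  rw [inv_mul_cancel_left₀ (by positivity)]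

lemma natDegree_choosePoly_le (c s : ℕ) : (choosePoly c s).natDegree ≤ s := by
  refine (natDegree_C_mul_le _ _).trans ?_
  rw [natDegree_comp, descPochhammer_natDegree, ← C_eq_natCast, natDegree_X_sub_C, mul_one]

lemma bellFunctional_mul_X_pow (q : ℚ[X]) (e N : ℕ) (hN : q.natDegree ≤ N) :
    bellFunctional ℚ (q * X ^ e) = ∑ i ∈ range (N + 1), q.coeff i * Nat.bell (e + i) := by
  conv_lhs => rw [as_sum_range_C_mul_X_pow' (n := N + 1) q (by omega)]
  rw [Finset.sum_mul, map_sum]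
  refine Finset.sum_congr rfl fun i _ => ?_
  rw [mul_assoc, bellFunctional_C_mul, ← pow_add, bellFunctional_X_pow, add_comm i]

/-- As b ≤ l, the factor (X)_b splits off from (X)_l and pays for the shift by b, which turns the
powers of X - b into powers of X. -/
lemma bellFunctional_descPochhammer_chooseGeom {l b : ℕ} (hb : b ≤ l) (s r : ℕ) (p : ℚ[X])
    (n : ℕ) :
    bellFunctional ℚ (descPochhammer ℚ l * chooseGeom b s r p n) = (n.choose s : ℚ) *
      bellFunctional ℚ (descPochhammer ℚ (l - b) * p.comp (X + (b : ℚ[X])) * X ^ (n - s + r)) := by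
  have h1 : descPochhammer ℚ l
      = descPochhammer ℚ b * (descPochhammer ℚ (l - b)).comp (X - (b : ℚ[X])) := by
    rw [descPochhammer_mul, Nat.add_sub_cancel' hb]
  have h2 : (X - (b : ℚ[X])).comp (X + (b : ℚ[X])) = X := by simp
  rw [h1, mul_assoc, bellFunctional_descPochhammer_mul, mul_comp, comp_assoc, h2, comp_X,
    ← bellFunctional_C_mul]
  congr 1
  simp only [chooseGeom, mul_comp, pow_comp, h2, natCast_comp, C_eq_natCast]
  ring

lemma exists_boundedBell_of_mem {l K T c k : ℕ} (hl : l ≤ k) (hk : K + c = k) {S : ℕ → ℚ[X]}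
    (hS : S ∈ chooseGeomSpan l K T) :
    ∃ R ∈ boundedBell k (k + T), ∀ n ≥ c,
      bellFunctional ℚ (descPochhammer ℚ l * S (n - c)) = evalAt R n := by
  induction hS using Submodule.span_induction with
  | zero => exact ⟨0, zero_mem _, by simp [evalAt]⟩
  | add S S' _ _ h h' =>
    obtain ⟨R, hR, h⟩ := h
    obtain ⟨R', hR', h'⟩ := h'
    refine ⟨R + R', add_mem hR hR', fun n hn => ?_⟩
    rw [evalAt_add, ← h n hn, ← h' n hn, Pi.add_apply, mul_add, map_add]
  | smul a S _ h =>
    obtain ⟨R, hR, h⟩ := h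
    refine ⟨a • R, Submodule.smul_mem _ _ hR, fun n hn => ?_⟩
    rw [evalAt_smul, ← h n hn, Pi.smul_apply, mul_smul_comm, map_smul, smul_eq_mul]
  | mem S hS =>
    obtain ⟨b, s, r, p, hb, hs, hr, rfl⟩ := hS
    set q := descPochhammer ℚ (l - b) * p.comp (X + (b : ℚ[X])) with hq
    have hqN : q.natDegree ≤ l - b + p.natDegree := by
      refine natDegree_mul_le.trans ?_
      rw [descPochhammer_natDegree, natDegree_comp, ← C_eq_natCast, natDegree_X_add_C, mul_one]
    refine ⟨∑ i ∈ range (l - b + p.natDegree + 1),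
      Finsupp.single ((i : ℤ) + r - c - s) (C (q.coeff i) * choosePoly c s),
      Submodule.sum_mem _ fun i hi => ?_, fun n hn => ?_⟩
    -- The index j = i + r - c - s is at least -k because s ≤ K + r and K + c = k. If j < 0, these
    -- force i < k, hence j + s = i + r - c < k + T: the gain of one degree at negative indices.
    · have := Finset.mem_range.1 hi
      exact single_mem_boundedBell ((natDegree_C_mul_le _ _).trans (natDegree_choosePoly_le c s))
        (by omega) (by omega) (by omega)
    · rw [bellFunctional_descPochhammer_chooseGeom hb, bellFunctional_mul_X_pow _ _ _ hqN,
        evalAt_sum, Finset.mul_sum]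
      refine Finset.sum_congr rfl fun i _ => ?_
      rw [evalAt_single, eval_mul, eval_C, choosePoly_eval hn]
      -- For n - c < s the Bell number may have negative index, but its coefficient C(n - c, s)
      -- vanishes.
      rcases lt_or_ge (n - c) s with h | h
      · rw [Nat.choose_eq_zero_of_lt h]; simp
      · rw [bellNumber, if_pos (by omega),
          show ((n : ℤ) + ((i : ℤ) + r - c - s)).toNat = n - c - s + r + i by omega]
        ring

end ShiftedBell

/-! ### Placements as sums over increasing tuples. -/

section Placements

/-- The number of entries of `x` below `y`. -/
def position {k : ℕ} (x : Fin k → ℕ) (y : ℕ) : ℕ := ∑ i, if x i < y then 1 else 0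

open Classical in
/-- The product of the factors `X - b (position x y)` over the points `y < n` that `x` avoids. -/
noncomputable def gapWeight (b : ℕ → ℕ) {k : ℕ} (x : Fin k → ℕ) (n : ℕ) : ℚ[X] :=
  ∏ y ∈ range n, if y ∈ Set.range x then 1 else X - (b (position x y) : ℚ[X])

open Classical in
/-- The strictly increasing `k`-tuples with entries below `n`. -/
noncomputable def increasingTuples (k n : ℕ) : Finset (Fin k → ℕ) :=
  {x ∈ Fintype.piFinset fun _ : Fin k => range n | StrictMono x}

/-- The entries `x j` with `j ∈ J`, `j ≥ 1`, are the successors of the preceding entries. -/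
def AdjacentOn (J : Finset ℕ) {k : ℕ} (x : Fin k → ℕ) : Prop :=
  ∀ i j : Fin k, (j : ℕ) = i + 1 → (j : ℕ) ∈ J → x j = x i + 1

lemma mem_increasingTuples {k n : ℕ} {x : Fin k → ℕ} :
    x ∈ increasingTuples k n ↔ (∀ i, x i < n) ∧ StrictMono x := by
  simp [increasingTuples]

lemma sum_increasingTuples_succ {M : Type*} [AddCommMonoid M] (k n : ℕ)
    (F : (Fin (k + 1) → ℕ) → M) :
    ∑ x ∈ increasingTuples (k + 1) n, F x
      = ∑ y ∈ range n, ∑ x ∈ increasingTuples k y, F (Fin.snoc x y : Fin (k + 1) → ℕ) := by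
  rw [Finset.sum_sigma']
  refine Finset.sum_nbij' (fun x => (⟨x (Fin.last k), Fin.init x⟩ : Σ _ : ℕ, Fin k → ℕ))
    (fun p => (Fin.snoc p.2 p.1 : Fin (k + 1) → ℕ)) ?_ ?_ ?_ ?_ ?_
  · intro x hx
    rw [mem_increasingTuples] at hx
    rw [Finset.mem_sigma, Finset.mem_range, mem_increasingTuples]
    exact ⟨hx.1 _, fun i => hx.2 (Fin.castSucc_lt_last i),
      fun i j hij => hx.2 (Fin.castSucc_lt_castSucc_iff.2 hij)⟩
  · rintro ⟨y, x⟩ hp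
    rw [Finset.mem_sigma, Finset.mem_range, mem_increasingTuples] at hp
    obtain ⟨hy, hx, hmono⟩ := hp
    rw [mem_increasingTuples]
    constructor
    · intro i
      cases i using Fin.lastCases with
      | last => simpa using hy
      | cast i => simpa using (hx i).trans hy
    · intro i j hij
      cases j using Fin.lastCases with
      | last =>
        cases i using Fin.lastCases with
        | last => exact absurd hij (lt_irrefl _)
        | cast i => simpa using hx i
      | cast j =>
        cases i using Fin.lastCases with
        | last => exact absurd hij (not_lt.2 (Fin.le_last _))
        | cast i => simpa using hmono (Fin.castSucc_lt_castSucc_iff.1 hij)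
  · intro x _; exact Fin.snoc_init_self x
  · rintro ⟨y, x⟩ _; simp
  · intro x _; simp

lemma range_snoc {k : ℕ} (x : Fin k → ℕ) (y : ℕ) :
    Set.range (Fin.snoc x y : Fin (k + 1) → ℕ) = insert y (Set.range x) := by
  ext z
  constructor
  · rintro ⟨i, rfl⟩
    cases i using Fin.lastCases with
    | last => simp
    | cast i => simp
  · rintro (rfl | ⟨i, rfl⟩)
    · exact ⟨Fin.last k, by simp⟩
    · exact ⟨i.castSucc, by simp⟩

lemma position_snoc {k : ℕ} (x : Fin k → ℕ) (y z : ℕ) :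
    position (Fin.snoc x y : Fin (k + 1) → ℕ) z = position x z + if y < z then 1 else 0 := by
  simp only [position, Fin.sum_univ_castSucc, Fin.snoc_castSucc, Fin.snoc_last]

/-- All n - 1 - y points beyond the last entry y lie in the same gap, the one with k + 1 entries to
its left. -/
lemma gapWeight_snoc (b : ℕ → ℕ) {k : ℕ} {x : Fin k → ℕ} {y n : ℕ}
    (hx : x ∈ increasingTuples k y) (hy : y < n) :
    gapWeight b (Fin.snoc x y : Fin (k + 1) → ℕ) n
      = gapWeight b x y * (X - (b (k + 1) : ℚ[X])) ^ (n - 1 - y) := by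
  rw [mem_increasingTuples] at hx
  obtain ⟨m, rfl⟩ := Nat.exists_eq_add_of_le (Nat.succ_le_of_lt hy)
  simp only [gapWeight, Finset.prod_range_add, range_snoc, Finset.prod_range_one,
    Nat.succ_eq_add_one]
  have h1 : ∀ z ∈ range m, (if y + 1 + z ∈ insert y (Set.range x) then (1 : ℚ[X])
      else X - (b (position (Fin.snoc x y : Fin (k + 1) → ℕ) (y + 1 + z)) : ℚ[X]))
      = X - (b (k + 1) : ℚ[X]) := by
    intro z _
    rw [if_neg, position_snoc, if_pos (by omega)]
    · have : position x (y + 1 + z) = k := by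
        rw [position, Finset.sum_congr rfl fun i _ => if_pos (by have := hx.1 i; omega)]
        simp
      rw [this]
    · rintro (h | ⟨i, hi⟩)
      · omega
      · have := hx.1 i; omega
  rw [Finset.prod_congr rfl h1]
  simp only [Finset.prod_const, Finset.card_range, add_zero, Set.mem_insert_iff, true_or, if_true,
    mul_one]
  congr 1
  · refine Finset.prod_congr rfl fun z hz => ?_
    have hz' := Finset.mem_range.1 hz
    rw [position_snoc, if_neg (by omega : ¬ y < z), add_zero]
    simp [hz'.ne]
  · congr 1; omega

lemma adjacentOn_snoc_succ (J : Finset ℕ) {k : ℕ} (x : Fin (k + 1) → ℕ) (y : ℕ) :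
    AdjacentOn J (Fin.snoc x y : Fin (k + 2) → ℕ)
      ↔ AdjacentOn J x ∧ (k + 1 ∈ J → y = x (Fin.last k) + 1) := by
  constructor
  · intro h
    refine ⟨fun i j hij hj => ?_, fun hJ => ?_⟩
    · simpa using h i.castSucc j.castSucc (by simpa using hij) (by simpa using hj)
    · simpa using h (Fin.last k).castSucc (Fin.last (k + 1)) (by simp) (by simpa using hJ)
  · rintro ⟨h1, h2⟩ i j hij hj
    cases j using Fin.lastCases with
    | last =>
      have hi : i = (Fin.last k).castSucc := by
        ext; simp at hij ⊢; omega
      subst hi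
      simpa using h2 (by simpa using hj)
    | cast j =>
      cases i using Fin.lastCases with
      | last =>
        have := j.2
        simp at hij; omega
      | cast i => simpa using h1 i j (by simpa using hij) (by simpa using hj)

lemma increasingTuples_zero (n : ℕ) : increasingTuples 0 n = {Fin.elim0} := by
  ext x
  rw [mem_increasingTuples, Finset.mem_singleton]
  exact ⟨fun _ => Subsingleton.elim _ _, fun _ => ⟨fun i => i.elim0, fun i => i.elim0⟩⟩

open Classical in
lemma placementsEndingAt_eq_sum (d b : ℕ → ℕ) (J : Finset ℕ) (i y : ℕ) :
    placementsEndingAt d b J i y = ∑ x ∈ increasingTuples i y,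
      if AdjacentOn J (Fin.snoc x y : Fin (i + 1) → ℕ) then
        (∏ j : Fin (i + 1), (((Fin.snoc x y : Fin (i + 1) → ℕ) j + 1 : ℕ) : ℚ[X]) ^ d j)
          * gapWeight b x y else 0 := by
  induction i generalizing y with
  | zero =>
    have hadj : AdjacentOn J (Fin.snoc Fin.elim0 y : Fin 1 → ℕ) := by
      intro i j hij; omega
    rw [increasingTuples_zero, Finset.sum_singleton, if_pos hadj]
    simp [placementsEndingAt, gapWeight, position, Fin.snoc]
  | succ i ih =>
    have hstep : ∀ z ∈ range y, ∑ x ∈ increasingTuples i z,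
        (if AdjacentOn J (Fin.snoc (Fin.snoc x z : Fin (i + 1) → ℕ) y : Fin (i + 2) → ℕ) then
          (∏ j : Fin (i + 2),
            (((Fin.snoc (Fin.snoc x z : Fin (i + 1) → ℕ) y : Fin (i + 2) → ℕ) j + 1 : ℕ) : ℚ[X])
              ^ d j) * gapWeight b (Fin.snoc x z : Fin (i + 1) → ℕ) y else 0)
        = ((y + 1 : ℕ) : ℚ[X]) ^ d (i + 1) * if (i + 1 ∈ J → y = z + 1) then
          placementsEndingAt d b J i z * (X - (b (i + 1) : ℚ[X])) ^ (y - 1 - z) else 0 := by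
      intro z hz
      rw [ih]
      split_ifs with hJ
      · rw [Finset.sum_mul, Finset.mul_sum]
        refine Finset.sum_congr rfl fun x hx => ?_
        rw [gapWeight_snoc b hx (Finset.mem_range.1 hz), Fin.prod_univ_castSucc]
        simp only [adjacentOn_snoc_succ, Fin.snoc_last, Fin.snoc_castSucc, Fin.val_castSucc,
          Fin.val_last]
        by_cases hadj : AdjacentOn J (Fin.snoc x z : Fin (i + 1) → ℕ)
        · rw [if_pos ⟨hadj, hJ⟩, if_pos hadj]; ring
        · rw [if_neg (fun h => hadj h.1), if_neg hadj]; simp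
      · rw [mul_zero]
        refine Finset.sum_eq_zero fun x _ => if_neg fun h => hJ ?_
        simpa using ((adjacentOn_snoc_succ J _ y).1 h).2
    rw [sum_increasingTuples_succ, Finset.sum_congr rfl hstep, ← Finset.mul_sum, placementsEndingAt]
    congr 1
    by_cases hJ : i + 1 ∈ J
    · simp only [hJ, if_true, true_imp_iff]
      cases y with
      | zero => simp
      | succ y =>
        rw [Finset.sum_eq_single y]
        · simp
        · intro z _ hz; rw [if_neg (by omega)]
        · intro h; simp at h
    · simp [hJ, geomConv]

open Classical in
lemma placements_eq_sum (d b : ℕ → ℕ) (J : Finset ℕ) (k n : ℕ) :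
    placements d b J k n = ∑ x ∈ increasingTuples k n with AdjacentOn J x,
      (∏ j : Fin k, ((x j + 1 : ℕ) : ℚ[X]) ^ d j) * gapWeight b x n := by
  rw [Finset.sum_filter]
  cases k with
  | zero =>
    have hadj : AdjacentOn J (Fin.elim0 : Fin 0 → ℕ) := fun i => i.elim0
    rw [increasingTuples_zero, Finset.sum_singleton, if_pos hadj]
    simp [placements, gapWeight, position]
  | succ k =>
    rw [sum_increasingTuples_succ, placements, geomConv]
    refine Finset.sum_congr rfl fun y hy => ?_
    rw [placementsEndingAt_eq_sum, Finset.sum_mul]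
    refine Finset.sum_congr rfl fun x hx => ?_
    rw [gapWeight_snoc b hx (Finset.mem_range.1 hy)]
    split_ifs
    · ring
    · simp

end Placements

/-! ### Set partitions as kernels of colorings. -/

section Colorings

lemma rel_iff_part_eq {n : ℕ} (l : SetPartition n) (i j : Fin n) :
    Rel l i j ↔ l.part i = l.part j := by
  rw [← Finpartition.mem_part_iff_part_eq_part _ (mem_univ _) (mem_univ _),
    Finpartition.mem_part_iff_exists]
  rfl

lemma parts_eq_image_part {n : ℕ} (l : SetPartition n) : l.parts = univ.image l.part := by
  ext b
  rw [Finset.mem_image]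
  constructor
  · intro hb
    obtain ⟨i, hi⟩ := l.nonempty_of_mem_parts hb
    exact ⟨i, mem_univ _, l.part_eq_of_mem hb hi⟩
  · rintro ⟨i, _, rfl⟩
    exact l.part_mem.2 (mem_univ _)

lemma ext_rel {n : ℕ} {l l' : SetPartition n} (h : ∀ i j, Rel l i j ↔ Rel l' i j) : l = l' := by
  have hpart : ∀ i, l.part i = l'.part i := by
    intro i
    ext j
    rw [Finpartition.mem_part_iff_part_eq_part _ (mem_univ _) (mem_univ _),
      Finpartition.mem_part_iff_part_eq_part _ (mem_univ _) (mem_univ _),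
      ← rel_iff_part_eq, ← rel_iff_part_eq, h]
  ext1
  rw [parts_eq_image_part, parts_eq_image_part]
  exact Finset.image_congr fun i _ => hpart i

/-- The partition of `[n]` into the fibres of a coloring. -/
def kerPartition {n m : ℕ} (φ : Fin n → Fin m) : SetPartition n :=
  letI : DecidableRel (Setoid.ker φ).r := fun i j => decEq (φ i) (φ j)
  Finpartition.ofSetoid (Setoid.ker φ)

lemma rel_kerPartition {n m : ℕ} (φ : Fin n → Fin m) (i j : Fin n) :
    Rel (kerPartition φ) i j ↔ φ i = φ j := by
  let : DecidableRel (Setoid.ker φ).r := fun i j => decEq (φ i) (φ j)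
  rw [rel_iff_part_eq, eq_comm, ← Finpartition.mem_part_iff_part_eq_part _ (mem_univ _) (mem_univ _)]
  exact Finpartition.mem_part_ofSetoid_iff_rel

/-- The fibres of `φ` are the blocks of `l`. -/
def IsColoring {n m : ℕ} (l : SetPartition n) (φ : Fin n → Fin m) : Prop :=
  ∀ i j, φ i = φ j ↔ Rel l i j

lemma isColoring_iff {n m : ℕ} {l : SetPartition n} {φ : Fin n → Fin m} :
    IsColoring l φ ↔ kerPartition φ = l := by
  constructor
  · intro h
    exact ext_rel fun i j => (rel_kerPartition φ i j).trans (h i j)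
  · rintro rfl i j
    exact (rel_kerPartition φ i j).symm

open Classical in
-- Such a coloring is an injection of the blocks into the m colors.
lemma card_colorings {n : ℕ} (l : SetPartition n) (m : ℕ) :
    #{φ : Fin n → Fin m | IsColoring l φ} = m.descFactorial #l.parts := by
  have hcard : Fintype.card (l.parts ↪ Fin m) = m.descFactorial #l.parts := by
    rw [Fintype.card_embedding_eq, Fintype.card_coe, Fintype.card_fin]
  rw [← hcard, ← Finset.card_univ]
  have hmem : ∀ i, l.part i ∈ l.parts := fun i => l.part_mem.2 (mem_univ i)
  symm
  refine Finset.card_bij (fun e _ i => e ⟨l.part i, hmem i⟩) ?_ ?_ ?_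
  · intro e _
    rw [Finset.mem_filter]
    refine ⟨mem_univ _, fun i j => ?_⟩
    rw [e.injective.eq_iff, Subtype.mk.injEq, rel_iff_part_eq]
  · intro e _ e' _ h
    ext1 ⟨b, hb⟩
    obtain ⟨i, hi⟩ := l.nonempty_of_mem_parts hb
    have := congrFun h i
    simpa only [l.part_eq_of_mem hb hi] using this
  · intro φ hφ
    replace hφ : IsColoring l φ := (Finset.mem_filter.1 hφ).2
    have hrep : ∀ b : l.parts, ∃ i, l.part i = b := fun b => by
      obtain ⟨i, hi⟩ := l.nonempty_of_mem_parts b.2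
      exact ⟨i, l.part_eq_of_mem b.2 hi⟩
    choose r hr using hrep
    refine ⟨⟨fun b => φ (r b), fun b b' hbb => ?_⟩, mem_univ _, ?_⟩
    · have := (hφ _ _).1 hbb
      rw [rel_iff_part_eq, hr, hr] at this
      exact Subtype.ext this
    · funext i
      refine (hφ _ _).2 ?_
      rw [rel_iff_part_eq, hr]

lemma sum_mul_descFactorial {n : ℕ} (g : SetPartition n → ℚ) (m : ℕ) :
    ∑ l, g l * (m.descFactorial #l.parts : ℚ) = ∑ φ : Fin n → Fin m, g (kerPartition φ) := by
  classical
  rw [← Finset.sum_fiberwise (s := univ) (g := fun φ : Fin n → Fin m => kerPartition φ)]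
  refine Finset.sum_congr rfl fun l _ => ?_
  rw [Finset.sum_congr rfl (g := fun _ => g l)
    (fun φ hφ => by rw [(Finset.mem_filter.1 hφ).2]), Finset.sum_const, ← card_colorings l m,
    nsmul_eq_mul, mul_comm]
  simp only [isColoring_iff]

end Colorings

/-! ### Counting colorings with an occurrence at a given place. -/

section Occurrences

variable {k : ℕ}

/-- The conditions of the pattern are compatible with its own partition. -/
structure Pattern.IsConsistent (P : Pattern k) : Prop where
  isFirst : ∀ i ∈ P.firsts, IsFirst P.partition i
  isLast : ∀ i ∈ P.lasts, IsLast P.partition i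
  isArc : ∀ p ∈ P.arcs, IsArc P.partition p.1 p.2
  consec : ∀ p ∈ P.consec, (p.1 : ℕ) = p.2 + 1 ∨ (p.2 : ℕ) = p.1 + 1

lemma sub_le_sub_of_strictMono_fin {n : ℕ} {s : Fin k → Fin n} (hs : StrictMono s) {i j : Fin k}
    (h : i ≤ j) : (j : ℕ) - i ≤ (s j : ℕ) - s i := by
  have h1 : ∀ t : ℕ, ∀ j : Fin k, (j : ℕ) = i + t → t + (s i : ℕ) ≤ s j := by
    intro t
    induction t with
    | zero => intro j hj; rw [show j = i from Fin.ext hj]; omega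
    | succ t ih =>
      intro j hj
      have hj' : (i : ℕ) + t < k := by have := j.2; omega
      have h2 := ih ⟨i + t, hj'⟩ rfl
      have h3 : s ⟨i + t, hj'⟩ < s j := hs (Fin.lt_def.2 (by simp only; omega))
      have h4 := Fin.lt_def.1 h3
      omega
  have := h1 (j - i) j (by have := Fin.le_def.1 h; omega)
  omega

/-- Conditions on an increasing occurrence pull back to the pattern, and entries at distance 1 have
neighbouring indices. Inconsistent patterns therefore have zero statistics and can be set aside. -/
lemma IsOccurrence.isConsistent {n : ℕ} {P : Pattern k} {l : SetPartition n} {s : Fin k → Fin n}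
    (h : IsOccurrence P l s) : P.IsConsistent where
  isFirst i hi j hij := h.strictMono.le_iff_le.1 (h.isFirst i hi _ ((h.rel_iff i j).2 hij))
  isLast i hi j hij := h.strictMono.le_iff_le.1 (h.isLast i hi _ ((h.rel_iff i j).2 hij))
  isArc p hp := by
    obtain ⟨h1, h2, h3⟩ := h.isArc p hp
    refine ⟨(h.rel_iff _ _).1 h1, h.strictMono.lt_iff_lt.1 h2, fun e he hlt => ?_⟩
    exact h.strictMono.le_iff_le.1 (h3 _ ((h.rel_iff _ _).2 he) (h.strictMono hlt))
  consec p hp := by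
    have h1 := h.consec p hp
    rcases lt_trichotomy p.1 p.2 with hlt | heq | hlt
    · right
      have h2 := sub_le_sub_of_strictMono_fin h.strictMono hlt.le
      have h3 := Fin.lt_def.1 (h.strictMono hlt)
      have := Fin.lt_def.1 hlt
      rw [abs_of_neg (by omega)] at h1
      omega
    · rw [heq, sub_self, abs_zero] at h1
      exact absurd h1 (by norm_num)
    · left
      have h2 := sub_le_sub_of_strictMono_fin h.strictMono hlt.le
      have h3 := Fin.lt_def.1 (h.strictMono hlt)
      have := Fin.lt_def.1 hlt
      rw [abs_of_pos (by omega)] at h1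
      omega

open Classical in
/-- The entries of the pattern whose blocks may not contain a point with `p` entries to its
left. -/
noncomputable def Pattern.forbidden (P : Pattern k) (p : ℕ) : Finset (Fin k) :=
  {e | (e ∈ P.firsts ∧ p ≤ e) ∨ (e ∈ P.lasts ∧ (e : ℕ) < p) ∨
    ∃ e', (e, e') ∈ P.arcs ∧ (e : ℕ) < p ∧ p ≤ e'}

/-- The number of blocks of the pattern that may not contain a point with `p` entries to its
left. -/
noncomputable def Pattern.numForbidden (P : Pattern k) (p : ℕ) : ℕ :=
  #((P.forbidden p).image P.partition.part)

lemma Pattern.numForbidden_le (P : Pattern k) (p : ℕ) :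
    P.numForbidden p ≤ #P.partition.parts := by
  rw [parts_eq_image_part P.partition]
  exact Finset.card_le_card (Finset.image_subset_image (subset_univ _))

lemma lt_iff_lt_position {x : Fin k → ℕ} (hx : StrictMono x) (e : Fin k) (y : ℕ) :
    x e < y ↔ (e : ℕ) < position x y := by
  have hpos : position x y = #{i | x i < y} := by rw [position, Finset.card_filter]
  constructor
  · intro h
    have : Finset.Iic e ⊆ ({i | x i < y} : Finset (Fin k)) := fun i hi => by
      rw [Finset.mem_filter]
      exact ⟨mem_univ _, (hx.monotone (Finset.mem_Iic.1 hi)).trans_lt h⟩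
    have := Finset.card_le_card this
    rw [Fin.card_Iic] at this
    omega
  · intro h
    by_contra hn
    have : ({i | x i < y} : Finset (Fin k)) ⊆ Finset.Iio e := fun i hi => by
      rw [Finset.mem_filter] at hi
      exact Finset.mem_Iio.2 (hx.lt_iff_lt.1 (by omega))
    have := Finset.card_le_card this
    rw [Fin.card_Iio] at this
    omega

/-- The condition on the positions in an occurrence of `P`, apart from the partition. -/
def IsPlacement (P : Pattern k) {n : ℕ} (s : Fin k → Fin n) : Prop :=
  StrictMono s ∧ ∀ p ∈ P.consec, |((s p.1 : ℕ) : ℤ) - ((s p.2 : ℕ) : ℤ)| = 1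

/-- Once the entries are colored, each condition constrains the other points one at a time, so their
colors can be chosen independently. -/
lemma isOccurrence_kerPartition_iff {n m : ℕ} {P : Pattern k} (hP : P.IsConsistent)
    {s : Fin k → Fin n} (hs : IsPlacement P s) (φ : Fin n → Fin m) :
    IsOccurrence P (kerPartition φ) s ↔ IsColoring P.partition (φ ∘ s) ∧
      ∀ y ∉ Set.range s, ∀ e ∈ P.forbidden (position (fun i => (s i : ℕ)) y), φ y ≠ φ (s e) := by
  have hmono : StrictMono (fun i => (s i : ℕ)) := fun i j hij => hs.1 hij
  have hlt : ∀ (e : Fin k) (y : Fin n),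
      s e < y ↔ (e : ℕ) < position (fun i => (s i : ℕ)) y := fun e y =>
    lt_iff_lt_position hmono e y
  have hgt : ∀ (e : Fin k) (y : Fin n), y ∉ Set.range s →
      (y < s e ↔ position (fun i => (s i : ℕ)) y ≤ e) := fun e y hy => by
    rw [← not_lt, ← hlt, not_lt]
    exact ⟨le_of_lt, fun h => lt_of_le_of_ne h fun heq => hy ⟨e, heq.symm⟩⟩
  constructor
  · intro h
    refine ⟨fun i j => ?_, fun y hy e he heq => ?_⟩
    · rw [← h.rel_iff, rel_kerPartition]; rfl
    · have hrel : Rel (kerPartition φ) (s e) y := (rel_kerPartition φ _ _).2 heq.symm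
      simp only [Pattern.forbidden, Finset.mem_filter, mem_univ, true_and, ← hlt, ← hgt _ y hy] at he
      rcases he with ⟨he, h1⟩ | ⟨he, h1⟩ | ⟨e', he, h1, h2⟩
      · exact absurd (h.isFirst e he y hrel) (not_le.2 h1)
      · exact absurd (h.isLast e he y hrel) (not_le.2 h1)
      · exact absurd ((h.isArc _ he).2.2 y hrel h1) (not_le.2 h2)
  · rintro ⟨hcol, hforb⟩
    have hrel : ∀ i j, Rel (kerPartition φ) (s i) (s j) ↔ Rel P.partition i j := fun i j => by
      rw [rel_kerPartition]; exact hcol i j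
    refine ⟨hs.1, hrel, fun i hi y hy => ?_, fun i hi y hy => ?_, fun p hp => ?_, hs.2⟩
    · by_cases hyr : y ∈ Set.range s
      · obtain ⟨j, rfl⟩ := hyr
        exact hs.1.monotone (hP.isFirst i hi j ((hrel i j).1 hy))
      · by_contra hn
        refine hforb y hyr i ?_ ((rel_kerPartition φ _ _).1 hy).symm
        simp only [Pattern.forbidden, Finset.mem_filter, mem_univ, true_and]
        exact Or.inl ⟨hi, (hgt i y hyr).1 (not_le.1 hn)⟩
    · by_cases hyr : y ∈ Set.range s
      · obtain ⟨j, rfl⟩ := hyr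
        exact hs.1.monotone (hP.isLast i hi j ((hrel i j).1 hy))
      · by_contra hn
        refine hforb y hyr i ?_ ((rel_kerPartition φ _ _).1 hy).symm
        simp only [Pattern.forbidden, Finset.mem_filter, mem_univ, true_and]
        exact Or.inr (Or.inl ⟨hi, (hlt i y).1 (not_le.1 hn)⟩)
    · obtain ⟨h1, h2, h3⟩ := hP.isArc p hp
      refine ⟨(hrel _ _).2 h1, hs.1 h2, fun y hy hlty => ?_⟩
      by_cases hyr : y ∈ Set.range s
      · obtain ⟨j, rfl⟩ := hyr
        exact hs.1.monotone (h3 j ((hrel _ j).1 hy) (hs.1.lt_iff_lt.1 hlty))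
      · by_contra hn
        refine hforb y hyr p.1 ?_ ((rel_kerPartition φ _ _).1 hy).symm
        simp only [Pattern.forbidden, Finset.mem_filter, mem_univ, true_and]
        exact Or.inr (Or.inr ⟨p.2, hp, (hlt _ y).1 hlty, (hgt _ y hyr).1 (not_le.1 hn)⟩)

lemma card_image_le_of_forall_eq {α β γ : Type*} [DecidableEq β] [DecidableEq γ] (S : Finset α)
    (f : α → β) (g : α → γ) (h : ∀ a b, g a = g b → f a = f b) : #(S.image f) ≤ #(S.image g) := by
  classical
  rcases S.eq_empty_or_nonempty with rfl | ⟨a, -⟩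
  · simp
  have : Nonempty α := ⟨a⟩
  have hex : ∀ c ∈ S.image f, ∃ a ∈ S, f a = c := fun c hc => Finset.mem_image.1 hc
  choose! r hrS hr using hex
  refine Finset.card_le_card_of_injOn (fun c => g (r c))
    (fun c hc => Finset.mem_coe.2 (Finset.mem_image_of_mem g (hrS c hc))) ?_
  intro c hc c' hc' hcc
  rw [← hr c hc, ← hr c' hc']
  exact h _ _ hcc

lemma card_image_forbidden {m : ℕ} (P : Pattern k) {ψ : Fin k → Fin m}
    (hψ : IsColoring P.partition ψ) (p : ℕ) : #((P.forbidden p).image ψ) = P.numForbidden p := by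
  have h : ∀ i j, ψ i = ψ j ↔ P.partition.part i = P.partition.part j := fun i j =>
    (hψ i j).trans (rel_iff_part_eq _ i j)
  exact le_antisymm (card_image_le_of_forall_eq _ _ _ fun i j => (h i j).2)
    (card_image_le_of_forall_eq _ _ _ fun i j => (h i j).1)

open Classical in
lemma card_colorings_extending {n m : ℕ} (P : Pattern k) {s : Fin k → Fin n}
    (hs : StrictMono s) {ψ : Fin k → Fin m} (hψ : IsColoring P.partition ψ) :
    (#{φ : Fin n → Fin m | φ ∘ s = ψ ∧ ∀ y ∉ Set.range s,
      ∀ e ∈ P.forbidden (position (fun i => (s i : ℕ)) y), φ y ≠ φ (s e)} : ℚ)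
      = (gapWeight P.numForbidden (fun i => (s i : ℕ)) n).eval (m : ℚ) := by
  have hset : ({φ : Fin n → Fin m | φ ∘ s = ψ ∧ ∀ y ∉ Set.range s,
      ∀ e ∈ P.forbidden (position (fun i => (s i : ℕ)) y), φ y ≠ φ (s e)} : Finset _)
      = Fintype.piFinset fun y : Fin n => if h : y ∈ Set.range s then {ψ h.choose}
        else univ \ (P.forbidden (position (fun i => (s i : ℕ)) y)).image ψ := by
    ext φ
    rw [Finset.mem_filter, Fintype.mem_piFinset]
    constructor
    · rintro ⟨-, h1, h2⟩ y
      split_ifs with hy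
      · rw [Finset.mem_singleton, ← h1, Function.comp_apply, hy.choose_spec]
      · rw [Finset.mem_sdiff, Finset.mem_image]
        refine ⟨mem_univ _, ?_⟩
        rintro ⟨e, he, heq⟩
        refine h2 y hy e he ?_
        rw [← heq, ← h1, Function.comp_apply]
    · intro h
      have h1 : φ ∘ s = ψ := by
        funext e
        have := h (s e)
        have hmem : s e ∈ Set.range s := ⟨e, rfl⟩
        rw [dif_pos hmem, Finset.mem_singleton] at this
        rw [Function.comp_apply, this, hs.injective hmem.choose_spec]
      refine ⟨mem_univ _, h1, fun y hy e he heq => ?_⟩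
      have := h y
      rw [dif_neg hy, Finset.mem_sdiff] at this
      refine this.2 (Finset.mem_image.2 ⟨e, he, ?_⟩)
      rw [heq, ← h1, Function.comp_apply]
  rw [hset, Fintype.card_piFinset, gapWeight, eval_prod, Finset.prod_range, Nat.cast_prod]
  refine Finset.prod_congr rfl fun y _ => ?_
  have hiff : (y : ℕ) ∈ Set.range (fun i => (s i : ℕ)) ↔ y ∈ Set.range s := by
    simp [Set.mem_range, Fin.ext_iff]
  by_cases hy : y ∈ Set.range s
  · rw [dif_pos hy, if_pos (hiff.2 hy)]; simp
  · rw [dif_neg hy, if_neg (fun h => hy (hiff.1 h)), Finset.card_sdiff_of_subset (subset_univ _),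
      card_image_forbidden P hψ, Nat.cast_sub]
    · simp
    -- The subtraction m - b is not truncated: the forbidden colors form a subset of the m colors.
    · rw [← card_image_forbidden P hψ]
      exact Finset.card_le_card (subset_univ _)

open Classical in
lemma card_isOccurrence_kerPartition {n : ℕ} {P : Pattern k} (hP : P.IsConsistent)
    {s : Fin k → Fin n} (hs : IsPlacement P s) (m : ℕ) :
    (#{φ : Fin n → Fin m | IsOccurrence P (kerPartition φ) s} : ℚ)
      = (descPochhammer ℚ #P.partition.parts
          * gapWeight P.numForbidden (fun i => (s i : ℕ)) n).eval (m : ℚ) := by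
  rw [Finset.card_eq_sum_card_fiberwise (f := fun φ => φ ∘ s)
    (t := {ψ : Fin k → Fin m | IsColoring P.partition ψ})]
  · rw [eval_mul, descPochhammer_eval_eq_descFactorial, ← card_colorings, Nat.cast_sum,
      ← nsmul_eq_mul, ← Finset.sum_const]
    refine Finset.sum_congr rfl fun ψ hψ => ?_
    replace hψ := (Finset.mem_filter.1 hψ).2
    rw [← card_colorings_extending P hs.1 hψ, Finset.filter_filter]
    congr 2
    ext φ
    simp only [Finset.mem_filter, mem_univ, true_and, isOccurrence_kerPartition_iff hP hs]
    constructor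
    · rintro ⟨⟨-, h⟩, h'⟩; exact ⟨h', h⟩
    · rintro ⟨rfl, h⟩; exact ⟨⟨hψ, h⟩, rfl⟩
  · intro φ hφ
    rw [Finset.mem_coe, Finset.mem_filter] at hφ
    exact Finset.mem_coe.2 (Finset.mem_filter.2
      ⟨mem_univ _, ((isOccurrence_kerPartition_iff hP hs φ).1 hφ.2).1⟩)

end Occurrences

/-! ### Aggregates of statistics. -/

section Aggregate

variable {k : ℕ}

/-- The indices `j` such that the entries `j - 1` and `j` of an occurrence have to be adjacent. -/
def Pattern.adjacent (P : Pattern k) : Finset ℕ :=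
  P.consec.image fun p => max (p.1 : ℕ) p.2

lemma isPlacement_iff {n : ℕ} {P : Pattern k} (hP : P.IsConsistent) (s : Fin k → Fin n) :
    IsPlacement P s ↔ StrictMono s ∧ AdjacentOn P.adjacent (fun i => (s i : ℕ)) := by
  refine and_congr_right fun hs => ⟨fun h i j hij hj => ?_, fun h p hp => ?_⟩
  · obtain ⟨p, hp, hmax⟩ := Finset.mem_image.1 hj
    have h1 := h p hp
    have hlt := Fin.lt_def.1 (hs (Fin.lt_def.2 (by omega : (i : ℕ) < j)))
    rcases hP.consec p hp with h2 | h2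
    · rw [h2, max_eq_left (by omega)] at hmax
      rw [show p.1 = j from Fin.ext (by omega), show p.2 = i from Fin.ext (by omega),
        abs_of_pos (by omega)] at h1
      simp only
      omega
    · rw [h2, max_eq_right (by omega)] at hmax
      rw [show p.2 = j from Fin.ext (by omega), show p.1 = i from Fin.ext (by omega),
        abs_of_neg (by omega)] at h1
      simp only
      omega
  · have hmem : max (p.1 : ℕ) p.2 ∈ P.adjacent := Finset.mem_image_of_mem _ hp
    rcases hP.consec p hp with h2 | h2
    · rw [max_eq_left (by omega)] at hmem
      have h3 : (s p.1 : ℕ) = s p.2 + 1 := h p.2 p.1 h2 hmem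
      rw [h3]; simp
    · rw [max_eq_right (by omega)] at hmem
      have h3 : (s p.2 : ℕ) = s p.1 + 1 := h p.1 p.2 h2 hmem
      rw [h3]; simp

open Classical in
lemma sum_isPlacement {n : ℕ} {P : Pattern k} (hP : P.IsConsistent) {M : Type*} [AddCommMonoid M]
    (F : (Fin k → ℕ) → M) :
    ∑ s : Fin k → Fin n with IsPlacement P s, F (fun i => (s i : ℕ))
      = ∑ x ∈ increasingTuples k n with AdjacentOn P.adjacent x, F x := by
  refine Finset.sum_bij (fun s _ i => (s i : ℕ)) ?_ ?_ ?_ fun _ _ => rfl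
  · intro s hs
    obtain ⟨h1, h2⟩ := (isPlacement_iff hP s).1 (Finset.mem_filter.1 hs).2
    exact Finset.mem_filter.2 ⟨mem_increasingTuples.2 ⟨fun i => (s i).2, fun i j h => h1 h⟩, h2⟩
  · intro s _ s' _ h
    funext i
    exact Fin.ext (congrFun h i)
  · intro x hx
    obtain ⟨h1, h2⟩ := Finset.mem_filter.1 hx
    obtain ⟨h3, h4⟩ := mem_increasingTuples.1 h1
    exact ⟨fun i => ⟨x i, h3 i⟩, Finset.mem_filter.2
      ⟨mem_univ _, (isPlacement_iff hP _).2 ⟨fun i j h => h4 h, h2⟩⟩, rfl⟩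

/-- The value of `Q` at `y_i = x_i + 1` and `m = n`. -/
noncomputable def tupleValue (Q : MvPolynomial (Option (Fin k)) ℤ) (n : ℕ) (x : Fin k → ℕ) : ℤ :=
  MvPolynomial.eval (fun v : Option (Fin k) => v.elim (n : ℤ) fun i => (x i : ℤ) + 1) Q

open Classical in
lemma sum_value_smul_descPochhammer (σ : SimpleStatistic) (hP : σ.pattern.IsConsistent) (n : ℕ) :
    ∑ l : SetPartition n, C (σ.value l : ℚ) * descPochhammer ℚ #l.parts
      = descPochhammer ℚ #σ.pattern.partition.parts *
        ∑ x ∈ increasingTuples σ.length n with AdjacentOn σ.pattern.adjacent x,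
          C (tupleValue σ.poly n x : ℚ) * gapWeight σ.pattern.numForbidden x n := by
  -- At each natural number m both sides count pairs of a coloring with m colors and an occurrence
  -- in its kernel, weighted by the value of the polynomial.
  refine Polynomial.eq_of_infinite_eval_eq _ _ ?_
  refine (Set.infinite_range_of_injective (Nat.cast_injective (R := ℚ))).mono ?_
  rintro _ ⟨m, rfl⟩
  have h1 : ∀ s : Fin σ.length → Fin n, ¬ IsPlacement σ.pattern s →
      ∀ l : SetPartition n, ¬ IsOccurrence σ.pattern l s := fun s hs l h =>
    hs ⟨h.strictMono, h.consec⟩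
  rw [Set.mem_ofPred_eq, eval_finsetSum]
  simp only [eval_mul, eval_C, descPochhammer_eval_eq_descFactorial]
  rw [sum_mul_descFactorial (fun l => (σ.value l : ℚ)),
    ← sum_isPlacement hP fun x => C (tupleValue σ.poly n x : ℚ) *
      gapWeight σ.pattern.numForbidden x n,
    eval_finsetSum, Finset.mul_sum, Finset.sum_filter]
  simp only [SimpleStatistic.value, Int.cast_sum, Finset.sum_filter, Int.cast_ite, Int.cast_zero]
  rw [Finset.sum_comm]
  refine Finset.sum_congr rfl fun s _ => ?_
  split_ifs with hs
  · have h2 := card_isOccurrence_kerPartition hP hs m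
    rw [eval_mul, descPochhammer_eval_eq_descFactorial] at h2
    rw [← Finset.sum_filter, Finset.sum_const, nsmul_eq_mul, h2, eval_mul, eval_C]
    simp only [tupleValue]
    ring
  · exact Finset.sum_eq_zero fun φ _ => if_neg (h1 s hs _)

lemma sum_value_eq_bellFunctional (σ : SimpleStatistic) (n : ℕ) :
    ∑ l : SetPartition n, (σ.value l : ℚ) = bellFunctional ℚ
      (∑ l : SetPartition n, C (σ.value l : ℚ) * descPochhammer ℚ #l.parts) := by
  rw [map_sum]
  refine Finset.sum_congr rfl fun l _ => ?_
  rw [bellFunctional_C_mul, bellFunctional_descPochhammer, mul_one]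

/-- The exponents of the variables `y_i` in a monomial. -/
def exponents (μ : Option (Fin k) →₀ ℕ) (i : ℕ) : ℕ :=
  if h : i < k then μ (some ⟨i, h⟩) else 0

lemma tupleValue_eq_sum (Q : MvPolynomial (Option (Fin k)) ℤ) (n : ℕ) (x : Fin k → ℕ) :
    C (tupleValue Q n x : ℚ) = ∑ μ ∈ Q.support, C ((Q.coeff μ : ℤ) : ℚ) *
      ((n : ℚ[X]) ^ μ none * ∏ j : Fin k, ((x j + 1 : ℕ) : ℚ[X]) ^ exponents μ j) := by
  have : (tupleValue Q n x : ℚ) = ∑ μ ∈ Q.support, ((Q.coeff μ : ℤ) : ℚ) *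
      ((n : ℚ) ^ μ none * ∏ j : Fin k, ((x j + 1 : ℕ) : ℚ) ^ exponents μ j) := by
    rw [tupleValue, MvPolynomial.eval_eq']
    simp [Fintype.prod_option, exponents]
  rw [this, map_sum]
  simp

lemma sum_exponents_le {Q : MvPolynomial (Option (Fin k)) ℤ} {μ : Option (Fin k) →₀ ℕ}
    (hμ : μ ∈ Q.support) : ∑ j ∈ range k, exponents μ j + μ none ≤ Q.totalDegree := by
  refine le_trans (le_of_eq ?_) (MvPolynomial.le_totalDegree hμ)
  rw [Finsupp.sum_fintype _ _ (fun _ => rfl), Fintype.sum_option, add_comm, Finset.sum_range]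
  simp [exponents]

lemma exists_boundedBell_of_isConsistent (σ : SimpleStatistic) (hP : σ.pattern.IsConsistent) :
    ∃ R ∈ boundedBell σ.length σ.degree, ∀ n : ℕ, σ.length ≤ n + 1 →
      ∑ l : SetPartition n, (σ.value l : ℚ) = evalAt R n := by
  classical
  set k := σ.length with hk
  set P := σ.pattern
  set ℓ := #P.partition.parts with hℓ
  have hℓk : ℓ ≤ k := by
    simpa using P.partition.card_parts_le_card
  have hmono : ∀ μ ∈ σ.poly.support, ∃ R ∈ boundedBell k σ.degree, ∀ n : ℕ, k ≤ n + 1 →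
      bellFunctional ℚ (descPochhammer ℚ ℓ * ((n : ℚ[X]) ^ μ none *
        placements (exponents μ) P.numForbidden P.adjacent k n)) = evalAt R n := by
    intro μ hμ
    obtain ⟨c, hc, hm⟩ := placements_mem (exponents μ) P.numForbidden P.adjacent
      P.numForbidden_le k
    have hck : k - c + c = k := by omega
    obtain ⟨R, hR, h⟩ := exists_boundedBell_of_mem hℓk hck
      (natCast_add_pow_mul_mem hm c (μ none))
    refine ⟨R, boundedBell_mono le_rfl (Nat.add_le_add_left (sum_exponents_le hμ) k) hR,
      fun n hn => ?_⟩
    -- The bound c ≤ k - 1 makes the formula valid already at n = k - 1.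
    have hcn : c ≤ n := by omega
    simpa only [Nat.sub_add_cancel hcn] using h n hcn
  choose! R hR h using hmono
  refine ⟨∑ μ ∈ σ.poly.support, ((σ.poly.coeff μ : ℤ) : ℚ) • R μ,
    Submodule.sum_mem _ fun μ hμ => Submodule.smul_mem _ _ (hR μ hμ), fun n hn => ?_⟩
  rw [sum_value_eq_bellFunctional, sum_value_smul_descPochhammer σ hP, evalAt_sum]
  have h1 : ∑ x ∈ increasingTuples k n with AdjacentOn P.adjacent x,
      C (tupleValue σ.poly n x : ℚ) * gapWeight P.numForbidden x n
      = ∑ μ ∈ σ.poly.support, C ((σ.poly.coeff μ : ℤ) : ℚ) * ((n : ℚ[X]) ^ μ none *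
        placements (exponents μ) P.numForbidden P.adjacent k n) := by
    simp only [placements_eq_sum, tupleValue_eq_sum, Finset.sum_mul, Finset.mul_sum]
    rw [Finset.sum_comm]
    refine Finset.sum_congr rfl fun μ _ => Finset.sum_congr rfl fun x _ => ?_
    ring
  rw [h1, Finset.mul_sum, map_sum]
  refine Finset.sum_congr rfl fun μ hμ => ?_
  rw [mul_left_comm, bellFunctional_C_mul, h μ hμ n hn, evalAt_smul]

lemma exists_boundedBell_of_simpleStatistic (σ : SimpleStatistic) :
    ∃ R ∈ boundedBell σ.length σ.degree, ∀ n : ℕ, σ.length ≤ n + 1 →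
      ∑ l : SetPartition n, (σ.value l : ℚ) = evalAt R n := by
  by_cases hP : σ.pattern.IsConsistent
  · exact exists_boundedBell_of_isConsistent σ hP
  · refine ⟨0, zero_mem _, fun n _ => ?_⟩
    have h : ∀ l : SetPartition n, σ.value l = 0 := fun l => by
      rw [SimpleStatistic.value, Finset.sum_filter]
      exact Finset.sum_eq_zero fun s _ => if_neg fun h => hP h.isConsistent
    simp [h, evalAt]

lemma exists_boundedBell_of_represents {f : (n : ℕ) → SetPartition n → ℚ}
    {c : SimpleStatistic →₀ ℚ} (hc : Represents c f) :
    ∃ R ∈ boundedBell (maxLength c) (maxDegree c), ∀ n : ℕ, maxLength c ≤ n + 1 →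
      aggregate f n = evalAt R n := by
  choose R hR h using exists_boundedBell_of_simpleStatistic
  refine ⟨∑ σ ∈ c.support, c σ • R σ, Submodule.sum_mem _ fun σ hσ => Submodule.smul_mem _ _
    (boundedBell_mono (Finset.le_sup hσ) (Finset.le_sup hσ) (hR σ)), fun n hn => ?_⟩
  rw [aggregate, evalAt_sum, Finset.sum_congr rfl fun l _ => hc n l]
  simp only [Finsupp.sum]
  rw [Finset.sum_comm]
  refine Finset.sum_congr rfl fun σ hσ => ?_
  rw [evalAt_smul, ← h σ n ((Finset.le_sup (f := SimpleStatistic.length) hσ).trans hn),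
    Finset.mul_sum]

lemma evalAt_injective_of_eventually {R R' : ShiftedBellPolynomial} {n₀ : ℕ}
    (h : ∀ n ≥ n₀, evalAt R n = evalAt R' n) : R = R' := by
  rw [← sub_eq_zero]
  refine evalAt_eq_zero_imp _ n₀ fun n hn => ?_
  rw [sub_eq_add_neg, ← neg_one_smul ℚ R', evalAt_add, evalAt_smul, h n hn]
  ring

lemma exists_represents_maxDegree_eq_degree {f : (n : ℕ) → SetPartition n → ℚ}
    {c : SimpleStatistic →₀ ℚ} (hc : Represents c f) :
    ∃ c' : SimpleStatistic →₀ ℚ, Represents c' f ∧ maxDegree c' = degree f :=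
  Nat.sInf_mem (s := {d | ∃ c : SimpleStatistic →₀ ℚ, Represents c f ∧ maxDegree c = d})
    ⟨_, c, hc, rfl⟩

lemma neg_le_of_mem_support {k D : ℕ} {R : ShiftedBellPolynomial} (hR : R ∈ boundedBell k D)
    {j : ℤ} (hj : j ∈ R.support) : -(k : ℤ) ≤ j := by
  by_contra hn
  have := mem_boundedBell.1 hR j
  rw [coeffBound, if_pos (by omega), Submodule.mem_bot] at this
  exact Finsupp.mem_support_iff.1 hj this

lemma natDegree_lt_of_mem_support {k D : ℕ} {R : ShiftedBellPolynomial}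
    (hR : R ∈ boundedBell k D) {j : ℤ} (hj : j ∈ R.support) :
    ((R j).natDegree : ℤ) < D - j + if j < 0 then 0 else 1 := by
  have h := mem_boundedBell.1 hR j
  have hk := neg_le_of_mem_support hR hj
  rw [coeffBound, if_neg (by omega), mem_degreeLT,
    degree_eq_natDegree (Finsupp.mem_support_iff.1 hj)] at h
  have h' : (R j).natDegree < (D - j + if j < 0 then 0 else 1 : ℤ).toNat := by exact_mod_cast h
  omega

end Aggregate

end SetPartitionStat

theorem theorem2p2
    (f : (n : ℕ) → SetPartitionStat.SetPartition n → ℚ)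
    (c : SetPartitionStat.SimpleStatistic →₀ ℚ)
    (hc : SetPartitionStat.Represents c f) :
    ∃ R : SetPartitionStat.ShiftedBellPolynomial,
      (∀ n : ℕ, 1 ≤ n → SetPartitionStat.maxLength c ≤ n + 1 →
        SetPartitionStat.aggregate f n = SetPartitionStat.evalAt R n) ∧
      (∀ j ∈ R.support, j ≤ (SetPartitionStat.degree f : ℤ)) ∧
      (∀ j ∈ R.support, -(SetPartitionStat.maxLength c : ℤ) ≤ j) ∧
      (∀ j : ℕ, j ≤ SetPartitionStat.degree f →
        (R ((SetPartitionStat.degree f : ℤ) - (j : ℤ))).natDegree ≤ j) ∧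
      (∀ j : ℕ, SetPartitionStat.degree f < j →
        (R ((SetPartitionStat.degree f : ℤ) - (j : ℤ))).natDegree ≤ j - 1) := by
  obtain ⟨c', hc', hdeg⟩ := SetPartitionStat.exists_represents_maxDegree_eq_degree hc
  obtain ⟨R, hR, h⟩ := SetPartitionStat.exists_boundedBell_of_represents hc
  obtain ⟨R', hR', h'⟩ := SetPartitionStat.exists_boundedBell_of_represents hc'
  -- By uniqueness one R carries both sets of bounds: `c` supplies the range of n and the lowest
  -- index, and `c'`, which attains the degree of f, supplies the degrees of the coefficients and
  -- the highest index.
  obtain rfl : R = R' := SetPartitionStat.evalAt_injective_of_eventually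
    (n₀ := SetPartitionStat.maxLength c + SetPartitionStat.maxLength c') fun n hn => by
      rw [← h n (by omega), ← h' n (by omega)]
  rw [hdeg] at hR'
  refine ⟨R, fun n _ hn => h n hn, fun j hj => ?_,
    fun j hj => SetPartitionStat.neg_le_of_mem_support hR hj, fun j hj => ?_, fun j hj => ?_⟩
  · have := SetPartitionStat.natDegree_lt_of_mem_support hR' hj
    split_ifs at this <;> omega
  · by_cases hs : (SetPartitionStat.degree f : ℤ) - j ∈ R.support
    · have := SetPartitionStat.natDegree_lt_of_mem_support hR' hs
      rw [if_neg (by omega)] at this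
      omega
    · rw [Finsupp.notMem_support_iff.1 hs, Polynomial.natDegree_zero]
      exact Nat.zero_le _
  · by_cases hs : (SetPartitionStat.degree f : ℤ) - j ∈ R.support
    · have := SetPartitionStat.natDegree_lt_of_mem_support hR' hs
      rw [if_pos (by omega)] at this
      omega
    · rw [Finsupp.notMem_support_iff.1 hs, Polynomial.natDegree_zero]
      exact Nat.zero_le _
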